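/- **Setting.** Let $(M,h,\nabla)$ be a connected dually flat manifold of dimension $n$: $M$ is a connected (Hausdorff) smooth $n$-manifold, $h$ a Riemannian metric and $\nabla$ an affine connection such that both $\nabla$ and its dual connection $\nabla^*$, defined by $X(h(Y,Z))=h(\nabla_XY,Z)+h(Y,\nabla^*_XZ)$, have zero torsion and zero curvature. Let $X=(X_1,\dots,X_n)$ be vector fields on $M$ that are parallel with respect to $\nabla$ and form a basis of $T_pM$ for every $p\in M$, and let $L=\{\sum_i k_iX_i(p)\mid k\in\mathbb{Z}^n,\ p\in M\}\subset TM$ be the parallel lattice that they generate. *Kähler structure.* Let $\pi:TM\to M$ be the projection and $K:T(TM)\to TM$ the connector of $\nabla$ (so $K(Y_*v)=\nabla_vY$). Identify $T_u(TM)$ with $T_pM\oplus T_pM$, $p=\pi(u)$, by $A\mapsto(\pi_*A,KA)$. Dombrowski's Kähler structure on $TM$ is $g((v,w),(v',w'))=h(v,v')+h(w,w')$, $J(v,w)=(-w,v)$. Let $\Gamma(L)\cong\mathbb{Z}^n$ be the group of transformations $u\mapsto u+\sum_i k_iX_i(\pi(u))$, $k\in\mathbb{Z}^n$, of $TM$,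 let $M_L=TM/\Gamma(L)$ with quotient map $q_L$, and give $M_L$ the Kähler structure for which $q_L$ is a Kähler covering map (a covering map that is a local diffeomorphism, isometric and holomorphic). *Groups.* Let $\mathbb{T}^n=\mathbb{R}^n/\mathbb{Z}^n$ act on $M_L$ by $\Phi_{[t]}(q_L(u))=q_L(u+\sum_i t_iX_i(\pi(u)))$. Let $\mathrm{Diff}(M,h,L)$ be the group of isometries $\psi$ of $(M,h)$ with $\psi_*(L)=L$. For such $\psi$ let $R(\psi)\in \mathrm{GL}(n,\mathbb{Z})$ be the matrix with $\psi_*X_k(p)=\sum_i R(\psi)_{ik}X_i(\psi(p))$ for all $p\in M$ and all $k$, and form the semidirect product $\mathbb{T}^n\rtimes\mathrm{Diff}(M,h,L)$ with multiplication $([t],\psi)([t'],\psi')=([t+R(\psi)t'],\psi\circ\psi')$. Let $\mathrm{Aut}(M_L,g)^{\mathbb{T}^n}$ be the group of holomorphic isometries $\varphi$ of $M_L$ for which there is a Lie group isomorphism $\rho$ of $\mathbb{T}^n$ with $\varphi\circ\Phi_a=\Phi_{\rho(a)}\circ\varphi$ for all $a\in\mathbb{T}^n$. **Proposition.** The Kähler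 structure on $M_L$ is well defined, i.e. $q_L$ is a Kähler covering map for it, and the formula $$\Gamma_{([t],\psi)}(q_L(u))=q_L\Big(\psi_*u+\sum_{i=1}^n t_iX_i(\psi(\pi(u)))\Big)$$ defines a map $a\mapsto\Gamma_a$ from $\mathbb{T}^n\rtimes\mathrm{Diff}(M,h,L)$ to $\mathrm{Aut}(M_L,g)^{\mathbb{T}^n}$ which is a group isomorphism. -/

import Mathlib

open Set Topology Bundle FiberBundle
open scoped Manifold ContDiff Matrix

set_option linter.unusedSectionVars false

noncomputable section

namespace DuallyFlat

/-! ### The torus `ℝⁿ / ℤⁿ` -/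

section Torus

/-- The lattice `ℤⁿ ⊆ ℝⁿ`. -/
def intLattice (n : ℕ) : AddSubgroup (Fin n → ℝ) where
  carrier := {t | ∃ k : Fin n → ℤ, t = fun i => (k i : ℝ)}
  zero_mem' := ⟨0, by ext i; simp⟩
  add_mem' := by
    rintro _ _ ⟨k, rfl⟩ ⟨l, rfl⟩
    exact ⟨k + l, by ext i; simp⟩
  neg_mem' := by
    rintro _ ⟨k, rfl⟩
    exact ⟨-k, by ext i; simp⟩

/-- The torus `𝕋ⁿ = ℝⁿ / ℤⁿ`, with its quotient topology and group structure. -/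
abbrev Torus (n : ℕ) : Type := (Fin n → ℝ) ⧸ intLattice n

/-- The projection `t ↦ [t]`. -/
abbrev Torus.mk {n : ℕ} (t : Fin n → ℝ) : Torus n := QuotientAddGroup.mk t

theorem isDiscrete_intLattice (n : ℕ) : IsDiscrete (intLattice n : Set (Fin n → ℝ)) := by
  refine ⟨discreteTopology_subtype_iff'.2 ?_⟩
  rintro _ ⟨k, rfl⟩
  refine ⟨Metric.ball (fun i => (k i : ℝ)) 1, Metric.isOpen_ball, ?_⟩
  ext y
  simp only [mem_inter_iff, Metric.mem_ball, SetLike.mem_coe, mem_singleton_iff]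
  constructor
  · rintro ⟨hd, l, rfl⟩
    ext i
    have h1 := (dist_pi_lt_iff one_pos).1 hd i
    rw [Int.dist_cast_real, Int.dist_eq', ] at h1
    have h2 : |l i - k i| < 1 := by exact_mod_cast h1
    have : l i = k i := by rw [Int.abs_lt_one_iff] at h2; omega
    simp [this]
  · rintro rfl
    exact ⟨by simp, k, rfl⟩

theorem Torus.isQuotientCoveringMap_mk (n : ℕ) :
    IsAddQuotientCoveringMap (Torus.mk : (Fin n → ℝ) → Torus n) (intLattice n) :=
  AddSubgroup.isAddQuotientCoveringMap_of_comm _ (isDiscrete_intLattice n)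

/-- The manifold structure of `𝕋ⁿ` for which `ℝⁿ → 𝕋ⁿ` is a local diffeomorphism. -/
instance Torus.instChartedSpace (n : ℕ) : ChartedSpace (Fin n → ℝ) (Torus n) :=
  (Torus.isQuotientCoveringMap_mk n).isCoveringMap.isLocalHomeomorph.chartedSpace
    (Torus.isQuotientCoveringMap_mk n).surjective

/-- A group automorphism of `𝕋ⁿ` is a Lie group isomorphism if it and its inverse are smooth. -/
def IsLieGroupIso {n : ℕ} (ρ : Torus n ≃+ Torus n) : Prop :=
  ContMDiff 𝓘(ℝ, Fin n → ℝ) 𝓘(ℝ, Fin n → ℝ) ∞ ρ ∧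
    ContMDiff 𝓘(ℝ, Fin n → ℝ) 𝓘(ℝ, Fin n → ℝ) ∞ ρ.symm

/-- The endomorphism `[t] ↦ [A t]` of `𝕋ⁿ` given by an integer matrix `A`. -/
def torusEnd {n : ℕ} (A : Matrix (Fin n) (Fin n) ℤ) : Torus n →+ Torus n :=
  QuotientAddGroup.map (intLattice n) (intLattice n)
    (Matrix.mulVecLin (A.map ((↑) : ℤ → ℝ))).toAddMonoidHom (by
      rintro _ ⟨k, rfl⟩
      refine ⟨A *ᵥ k, ?_⟩
      ext i
      simp [Matrix.mulVec, dotProduct])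

@[simp]
theorem torusEnd_mk {n : ℕ} (A : Matrix (Fin n) (Fin n) ℤ) (t : Fin n → ℝ) :
    torusEnd A (Torus.mk t) = Torus.mk (A.map ((↑) : ℤ → ℝ) *ᵥ t) := rfl

theorem torusEnd_one {n : ℕ} (a : Torus n) :
    torusEnd (1 : Matrix (Fin n) (Fin n) ℤ) a = a := by
  induction a using QuotientAddGroup.induction_on with
  | H t =>
    rw [torusEnd_mk, Matrix.map_one _ Int.cast_zero Int.cast_one, Matrix.one_mulVec]

theorem torusEnd_mul {n : ℕ} (A B : Matrix (Fin n) (Fin n) ℤ) (a : Torus n) :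
    torusEnd (A * B) a = torusEnd A (torusEnd B a) := by
  induction a using QuotientAddGroup.induction_on with
  | H t =>
    rw [torusEnd_mk, torusEnd_mk, torusEnd_mk, Matrix.mulVec_mulVec]
    congr 2
    ext i j
    simp [Matrix.mul_apply]

/-- The homomorphism `GL(n, ℤ) → Aut(𝕋ⁿ)`, `A ↦ ρ_A`, where `ρ_A [t] = [A t]`. -/
def torusAut (n : ℕ) : GL (Fin n) ℤ →* MulAut (Multiplicative (Torus n)) where
  toFun A := AddEquiv.toMultiplicative
    { toFun := torusEnd (A : Matrix (Fin n) (Fin n) ℤ)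
      invFun := torusEnd ((A⁻¹ : GL (Fin n) ℤ) : Matrix (Fin n) (Fin n) ℤ)
      left_inv := fun a => by
        rw [← torusEnd_mul, ← Units.val_mul, inv_mul_cancel, Units.val_one, torusEnd_one]
      right_inv := fun a => by
        rw [← torusEnd_mul, ← Units.val_mul, mul_inv_cancel, Units.val_one, torusEnd_one]
      map_add' := map_add _ }
  map_one' := by
    ext a
    exact torusEnd_one a.toAdd
  map_mul' A B := by
    ext a
    exact torusEnd_mul _ _ a.toAdd

end Torus

/-! ### Dually flat manifolds -/

section Manifold

variable {n : ℕ} {M : Type*} [TopologicalSpace M] [ChartedSpace (EuclideanSpace ℝ (Fin n)) M]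

/-- Vector fields on an `n`-dimensional manifold, as dependent functions (no regularity). -/
abbrev VField (n : ℕ) (M : Type*) [TopologicalSpace M]
    [ChartedSpace (EuclideanSpace ℝ (Fin n)) M] : Type _ :=
  (p : M) → TangentSpace (𝓡 n) p

/-- The tangent bundle `TM`. -/
abbrev TM (n : ℕ) (M : Type*) [TopologicalSpace M]
    [ChartedSpace (EuclideanSpace ℝ (Fin n)) M] : Type _ :=
  TangentBundle (𝓡 n) M

variable [IsManifold (𝓡 n) ∞ M]

/-- Smooth vector fields. -/
def IsSmoothField (X : VField n M) : Prop :=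
  ContMDiff (𝓡 n) (𝓡 n).tangent ∞ (fun p => (⟨p, X p⟩ : TM n M))

/-- Affine connections on `M`: `cov Y p v` is `(∇_v Y)(p)`. -/
abbrev AffineConnection (n : ℕ) (M : Type*) [TopologicalSpace M]
    [ChartedSpace (EuclideanSpace ℝ (Fin n)) M] [IsManifold (𝓡 n) ∞ M] : Type _ :=
  CovariantDerivative (𝓡 n) (EuclideanSpace ℝ (Fin n)) (TangentSpace (𝓡 n) : M → Type _)

/-- Smooth Riemannian metrics on `M`. -/
abbrev Metric (n : ℕ) (M : Type*) [TopologicalSpace M]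
    [ChartedSpace (EuclideanSpace ℝ (Fin n)) M] [IsManifold (𝓡 n) ∞ M] : Type _ :=
  ContMDiffRiemannianMetric (𝓡 n) ∞ (EuclideanSpace ℝ (Fin n))
    (TangentSpace (𝓡 n) : M → Type _)


/-- The torsion and the curvature tensor
`R(X, Y) Z = ∇_X ∇_Y Z - ∇_Y ∇_X Z - ∇_{[X, Y]} Z` of the connection vanish. -/
structure IsFlat (cov : AffineConnection n M) : Prop where
  torsion : cov.torsion = 0
  curvature : ∀ X Y Z : VField n M, IsSmoothField X → IsSmoothField Y → IsSmoothField Z →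
    ∀ p : M, cov (fun q => cov Z q (Y q)) p (X p) - cov (fun q => cov Z q (X q)) p (Y p)
      - cov Z p (VectorField.mlieBracket (𝓡 n) X Y p) = 0

/-- `cov'` is the dual of `cov` with respect to `h`:
`X (h(Y, Z)) = h(∇_X Y, Z) + h(Y, ∇*_X Z)`. -/
def IsDualConnection (h : Metric n M) (cov cov' : AffineConnection n M) : Prop :=
  ∀ X Y Z : VField n M, IsSmoothField X → IsSmoothField Y → IsSmoothField Z → ∀ p : M,
    mfderiv (𝓡 n) 𝓘(ℝ, ℝ) (fun q => h.inner q (Y q) (Z q)) p (X p) =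
      h.inner p (cov Y p (X p)) (Z p) + h.inner p (Y p) (cov' Z p (X p))

/-- `(M, h, ∇)` is dually flat: `∇` is a smooth connection and both `∇` and its dual (which is
unique as an operator on smooth vector fields) are flat. -/
structure IsDuallyFlat (h : Metric n M) (cov : AffineConnection n M) : Prop where
  smooth : CovariantDerivative.ContMDiffCovariantDerivative cov ∞
  flat : IsFlat cov
  flat_dual : ∃ cov' : AffineConnection n M,
    CovariantDerivative.ContMDiffCovariantDerivative cov' ∞ ∧ IsDualConnection h cov cov' ∧ IsFlat cov'

/-! ### Dombrowski's construction on `TM` -/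

/-- The `q`-component of a vector of `T_u(TM)`, where `(q, r)` are the coordinates of `TM` attached
to the preferred chart `x` of `M` at `p = π(u)`. (Mathlib identifies `T_u(TM)` with the coordinate
space of `(q, r)`, and `T_pM` with the coordinate space of `x`.) -/
def qPart (u : TM n M) : TangentSpace (𝓡 n).tangent u →L[ℝ] TangentSpace (𝓡 n) u.1 :=
  ContinuousLinearMap.fst ℝ (EuclideanSpace ℝ (Fin n)) (EuclideanSpace ℝ (Fin n))

/-- The `r`-component of a vector of `T_u(TM)`. -/
def rPart (u : TM n M) : TangentSpace (𝓡 n).tangent u →L[ℝ] TangentSpace (𝓡 n) u.1 :=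
  ContinuousLinearMap.snd ℝ (EuclideanSpace ℝ (Fin n)) (EuclideanSpace ℝ (Fin n))

/-- The connector `K_u : T_u(TM) → T_pM`, where `p = π(u)`: it sends `∂/∂q_a` to
`(∇_{∂_a} ũ)(p) = ∑ Γ_{aj}^k(p) u_j ∂/∂x_k`, where `ũ = ∑ u_j ∂/∂x_j` is the extension of `u` with
constant coefficients near `p`, and it sends `∂/∂r_a` to `∂/∂x_a`. -/
def connector (cov : AffineConnection n M) (u : TM n M) :
    TangentSpace (𝓡 n).tangent u →L[ℝ] TangentSpace (𝓡 n) u.1 :=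
  rPart u + (cov (extend (EuclideanSpace ℝ (Fin n)) u.2) u.1).comp (qPart u)

/-- The derivative `π_* : T_u(TM) → T_pM` of the projection `π : TM → M`. -/
def projDeriv (u : TM n M) : TangentSpace (𝓡 n).tangent u →L[ℝ] TangentSpace (𝓡 n) u.1 :=
  mfderiv (𝓡 n).tangent (𝓡 n) (TotalSpace.proj : TM n M → M) u

theorem extChartAt_tangent (u w : TM n M) :
    extChartAt (𝓡 n).tangent u w = (extChartAt (𝓡 n) u.1 w.1,
      (trivializationAt (EuclideanSpace ℝ (Fin n)) (TangentSpace (𝓡 n)) u.1 w).2) := by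
  rw [FiberBundle.extChartAt]
  rfl

theorem projDeriv_eq (u : TM n M) : projDeriv u = qPart u := by
  have hm : MDifferentiableAt (𝓡 n).tangent (𝓡 n) (TotalSpace.proj : TM n M → M) u :=
    mdifferentiableAt_proj _
  have key : ∀ z ∈ (extChartAt (𝓡 n).tangent u).target,
      writtenInExtChartAt (𝓡 n).tangent (𝓡 n) u (TotalSpace.proj : TM n M → M) z = z.1 := by
    intro z hz
    have h := (extChartAt (𝓡 n).tangent u).right_inv hz
    rw [extChartAt_tangent] at h
    exact congrArg Prod.fst h
  rw [projDeriv, hm.mfderiv]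
  have h1 : fderivWithin ℝ (Prod.fst : EuclideanSpace ℝ (Fin n) × EuclideanSpace ℝ (Fin n) → _)
      (range (𝓡 n).tangent) (extChartAt (𝓡 n).tangent u u) = qPart u := by
    rw [ModelWithCorners.range_eq_univ, fderivWithin_univ]
    exact (hasFDerivAt_fst (𝕜 := ℝ)).fderiv
  rw [← h1]
  refine Filter.EventuallyEq.fderivWithin_eq ?_ (key _ (mem_extChartAt_target u))
  exact Filter.eventually_of_mem (extChartAt_target_mem_nhdsWithin u) key

theorem hasMFDerivAt_rCoord (u : TM n M) :
    HasMFDerivAt (𝓡 n).tangent 𝓘(ℝ, EuclideanSpace ℝ (Fin n)) (fun w : TM n M =>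
      (trivializationAt (EuclideanSpace ℝ (Fin n)) (TangentSpace (𝓡 n)) u.1 w).2) u (rPart u) := by
  have hm : MDifferentiableAt (𝓡 n).tangent 𝓘(ℝ, EuclideanSpace ℝ (Fin n)) (fun w : TM n M =>
      (trivializationAt (EuclideanSpace ℝ (Fin n)) (TangentSpace (𝓡 n)) u.1 w).2) u :=
    ((mdifferentiableAt_totalSpace (𝓡 n) (fun w : TM n M => w)).1 mdifferentiableAt_id).2
  have key : ∀ z ∈ (extChartAt (𝓡 n).tangent u).target,
      writtenInExtChartAt (𝓡 n).tangent 𝓘(ℝ, EuclideanSpace ℝ (Fin n)) u (fun w : TM n M =>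
        (trivializationAt (EuclideanSpace ℝ (Fin n)) (TangentSpace (𝓡 n)) u.1 w).2) z = z.2 := by
    intro z hz
    have h := (extChartAt (𝓡 n).tangent u).right_inv hz
    rw [extChartAt_tangent] at h
    exact congrArg Prod.snd h
  have h1 : fderivWithin ℝ (Prod.snd : EuclideanSpace ℝ (Fin n) × EuclideanSpace ℝ (Fin n) → _)
      (range (𝓡 n).tangent) (extChartAt (𝓡 n).tangent u u) = rPart u := by
    rw [ModelWithCorners.range_eq_univ, fderivWithin_univ]
    exact fderiv_snd
  have h2 : mfderiv (𝓡 n).tangent 𝓘(ℝ, EuclideanSpace ℝ (Fin n)) (fun w : TM n M =>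
      (trivializationAt (EuclideanSpace ℝ (Fin n)) (TangentSpace (𝓡 n)) u.1 w).2) u = rPart u := by
    rw [hm.mfderiv, ← h1]
    refine Filter.EventuallyEq.fderivWithin_eq ?_ (key _ (mem_extChartAt_target u))
    exact Filter.eventually_of_mem (extChartAt_target_mem_nhdsWithin u) key
  rw [← h2]
  exact hm.hasMFDerivAt

theorem qPart_mfderiv (Y : VField n M) (p : M)
    (hY : MDifferentiableAt (𝓡 n) (𝓡 n).tangent (fun q => (⟨q, Y q⟩ : TM n M)) p)
    (v : TangentSpace (𝓡 n) p) :
    qPart ⟨p, Y p⟩ (mfderiv (𝓡 n) (𝓡 n).tangent (fun q => (⟨q, Y q⟩ : TM n M)) p v) = v := by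
  have h := mfderiv_comp (I := 𝓡 n) (I' := (𝓡 n).tangent) (I'' := 𝓡 n) p
    (g := (TotalSpace.proj : TM n M → M)) (f := fun q => (⟨q, Y q⟩ : TM n M))
    (mdifferentiableAt_proj _) hY
  have h' : (TotalSpace.proj : TM n M → M) ∘ (fun q => (⟨q, Y q⟩ : TM n M)) = id := rfl
  rw [h', mfderiv_id] at h
  rw [← projDeriv_eq]
  exact (congrArg (fun L => L v) h).symm

theorem rPart_mfderiv (Y : VField n M) (p : M)
    (hY : MDifferentiableAt (𝓡 n) (𝓡 n).tangent (fun q => (⟨q, Y q⟩ : TM n M)) p)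
    (v : TangentSpace (𝓡 n) p) :
    rPart ⟨p, Y p⟩ (mfderiv (𝓡 n) (𝓡 n).tangent (fun q => (⟨q, Y q⟩ : TM n M)) p v) =
      mfderiv (𝓡 n) 𝓘(ℝ, EuclideanSpace ℝ (Fin n)) (fun q =>
        (trivializationAt (EuclideanSpace ℝ (Fin n)) (TangentSpace (𝓡 n)) p
          (⟨q, Y q⟩ : TM n M)).2) p v := by
  have h := ((hasMFDerivAt_rCoord (⟨p, Y p⟩ : TM n M)).comp p hY.hasMFDerivAt).mfderiv
  exact (congrArg (fun L => L v) h).symm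

/-- The connector is characterized by `K (Y_* v) = ∇_v Y`. -/
theorem connector_mfderiv (cov : AffineConnection n M) (Y : VField n M) (p : M)
    (hY : MDifferentiableAt (𝓡 n) (𝓡 n).tangent (fun q => (⟨q, Y q⟩ : TM n M)) p)
    (v : TangentSpace (𝓡 n) p) :
    connector cov ⟨p, Y p⟩ (mfderiv (𝓡 n) (𝓡 n).tangent (fun q => (⟨q, Y q⟩ : TM n M)) p v)
      = cov Y p v := by
  set e := trivializationAt (EuclideanSpace ℝ (Fin n)) (TangentSpace (𝓡 n) : M → Type _) p
    with he
  have hb : ∀ᶠ q in 𝓝 p, q ∈ e.baseSet :=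
    e.open_baseSet.mem_nhds (mem_baseSet_trivializationAt _ _ p)
  have hl : ∀ q (hq : q ∈ e.baseSet) v,
    (e (⟨q, v⟩ : TM n M)).2 = e.continuousLinearEquivAt ℝ q hq v := fun q hq v => rfl
  let c : VField n M → M → EuclideanSpace ℝ (Fin n) := fun σ q => (e (⟨q, σ q⟩ : TM n M)).2
  have hc : ∀ {σ : VField n M},
      MDifferentiableAt (𝓡 n) (𝓡 n).tangent (fun q => (⟨q, σ q⟩ : TM n M)) p →
      MDifferentiableAt (𝓡 n) 𝓘(ℝ, EuclideanSpace ℝ (Fin n)) (c σ) p := fun hσ =>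
    (mdifferentiableAt_section _ _).1 hσ
  have hcp : ∀ σ : VField n M, c σ p = σ p := fun σ =>
    (tangentBundleCore (𝓡 n) M).coordChange_self (achart _ p) p (mem_achart_source _ p) (σ p)
  let D : VField n M → (TangentSpace (𝓡 n) p →L[ℝ] TangentSpace (𝓡 n) p) := fun σ =>
    mvfderiv (𝓡 n) (c σ) p
  have hD : ∀ {σ : VField n M} {f : M → EuclideanSpace ℝ (Fin n)}, c σ =ᶠ[𝓝 p] f →
      D σ = mvfderiv (𝓡 n) f p := by
    intro σ f h
    exact h.mfderiv_eq
  have hΦ : TensorialAt (𝓡 n) (EuclideanSpace ℝ (Fin n)) (fun σ => cov σ p - D σ) p := by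
    constructor
    · intro f σ hf hσ
      have h1 : c (f • σ) =ᶠ[𝓝 p] f • c σ := by
        filter_upwards [hb] with q hq
        exact (hl q hq _).trans (map_smul (e.continuousLinearEquivAt ℝ q hq) _ _)
      have h2 : D (f • σ) = f p • D σ + (mvfderiv (𝓡 n) f p).smulRight (σ p) := by
        rw [hD h1, mvfderiv_smul hf (hc hσ), hcp]
        rfl
      rw [h2, cov.isCovariantDerivativeOnUniv.leibniz hσ hf, smul_sub]
      abel
    · intro σ τ hσ hτ
      have h1 : c (σ + τ) =ᶠ[𝓝 p] c σ + c τ := by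
        filter_upwards [hb] with q hq
        exact (hl q hq _).trans (map_add (e.continuousLinearEquivAt ℝ q hq) _ _)
      have h2 : D (σ + τ) = D σ + D τ := by
        rw [hD h1, mvfderiv_add (hc hσ) (hc hτ)]
        rfl
      rw [h2, cov.isCovariantDerivativeOnUniv.add hσ hτ]
      abel
  have h1 := hΦ.pointwise hY
    (mdifferentiableAt_extend (𝓡 n) (EuclideanSpace ℝ (Fin n)) (Y p))
    (extend_apply_self _ _).symm
  have h2 : D (extend (EuclideanSpace ℝ (Fin n)) (Y p)) = 0 := by
    have h3 : c (extend (EuclideanSpace ℝ (Fin n)) (Y p)) =ᶠ[𝓝 p] fun _ => (e ⟨p, Y p⟩).2 := by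
      filter_upwards [hb] with q hq
      have h4 : extend (EuclideanSpace ℝ (Fin n)) (Y p) q = e.symm q (e ⟨p, Y p⟩).2 := rfl
      simp only [c, h4]
      rw [e.apply_mk_symm hq]
    rw [hD h3, mvfderiv_const]
    rfl
  change rPart ⟨p, Y p⟩ _ + cov (extend (EuclideanSpace ℝ (Fin n)) (Y p)) p (qPart ⟨p, Y p⟩ _) = _
  rw [qPart_mfderiv Y p hY, rPart_mfderiv Y p hY]
  change D Y v + _ = _
  rw [h2, sub_zero] at h1
  rw [← h1]
  exact add_sub_cancel (D Y v) (cov Y p v)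

/-- The identification `T_u(TM) ≃ T_pM × T_pM`, `A ↦ (π_* A, K A)`. -/
def splitting (cov : AffineConnection n M) (u : TM n M) :
    TangentSpace (𝓡 n).tangent u ≃ₗ[ℝ] TangentSpace (𝓡 n) u.1 × TangentSpace (𝓡 n) u.1 :=
  LinearEquiv.ofBijective ((projDeriv u).prod (connector cov u)).toLinearMap (by
    rw [projDeriv_eq]
    constructor
    · intro A B hAB
      obtain ⟨h1, h2⟩ := Prod.ext_iff.1 hAB
      change qPart u A = qPart u B at h1
      change rPart u A + cov (extend (EuclideanSpace ℝ (Fin n)) u.2) u.1 (qPart u A) =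
        rPart u B + cov (extend (EuclideanSpace ℝ (Fin n)) u.2) u.1 (qPart u B) at h2
      rw [h1] at h2
      exact Prod.ext h1 ((add_left_inj (G := TangentSpace (𝓡 n) u.1) _).1 h2)
    · rintro ⟨v, w⟩
      exact ⟨(v, w - cov (extend (EuclideanSpace ℝ (Fin n)) u.2) u.1 v),
        Prod.ext rfl (sub_add_cancel w _)⟩)

/-- The Riemannian metric on `TM`: `g((v, w), (v', w')) = h(v, v') + h(w, w')`. -/
def tangentMetric (h : Metric n M) (cov : AffineConnection n M) (u : TM n M)
    (A B : TangentSpace (𝓡 n).tangent u) : ℝ :=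
  h.inner u.1 (projDeriv u A) (projDeriv u B) +
    h.inner u.1 (connector cov u A) (connector cov u B)

/-- The complex structure on `TM`: `J (v, w) = (-w, v)`. -/
def tangentJ (cov : AffineConnection n M) (u : TM n M)
    (A : TangentSpace (𝓡 n).tangent u) : TangentSpace (𝓡 n).tangent u :=
  (splitting cov u).symm (-connector cov u A, projDeriv u A)

/-! ### Parallel lattices -/

/-- A frame `X = (X₁, …, Xₙ)` of smooth vector fields which are parallel with respect to `∇`. -/
structure ParallelFrame (cov : AffineConnection n M) where
  /-- The vector fields. -/
  X : Fin n → VField n M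
  smooth : ∀ i, IsSmoothField (X i)
  parallel : ∀ i p, cov (X i) p = 0
  linearIndependent : ∀ p, LinearIndependent ℝ (fun i => X i p)
  span : ∀ p, ⊤ ≤ Submodule.span ℝ (range fun i => X i p)

namespace ParallelFrame

variable {cov : AffineConnection n M} (X : ParallelFrame cov)

/-- The translation `u ↦ u + t₁ X₁ + ⋯ + tₙ Xₙ` of `TM`. -/
def translate (t : Fin n → ℝ) (u : TM n M) : TM n M :=
  ⟨u.1, u.2 + ∑ i, t i • X.X i u.1⟩

/-- The parallel lattice `L = {k₁ X₁(p) + ⋯ + kₙ Xₙ(p) | k ∈ ℤⁿ, p ∈ M}` generated by `X`. -/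
def lattice : Set (TM n M) :=
  {u | ∃ k : Fin n → ℤ, u.2 = ∑ i, k i • X.X i u.1}

/-- The basis `X₁(p), …, Xₙ(p)` of `T_pM`. -/
def basis (p : M) : Module.Basis (Fin n) ℝ (TangentSpace (𝓡 n) p) :=
  Module.Basis.mk (X.linearIndependent p) (X.span p)

@[simp]
theorem basis_apply (p : M) (i : Fin n) : X.basis p i = X.X i p := by
  simp [basis]

/-- The coordinates of a tangent vector in the frame `X`. -/
def coord (u : TM n M) : Fin n → ℝ := (X.basis u.1).equivFun u.2

theorem sum_coord (u : TM n M) : ∑ i, X.coord u i • X.X i u.1 = u.2 := by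
  simpa [coord] using (X.basis u.1).sum_equivFun u.2

theorem eq_coord {u : TM n M} {t : Fin n → ℝ} (ht : u.2 = ∑ i, t i • X.X i u.1) :
    X.coord u = t := by
  have : u.2 = (X.basis u.1).equivFun.symm t := by
    simp [Module.Basis.equivFun_symm_apply, ht]
  rw [coord, this, LinearEquiv.apply_symm_apply]

theorem coord_translate (t : Fin n → ℝ) (u : TM n M) :
    X.coord (X.translate t u) = X.coord u + t := by
  apply X.eq_coord
  have h := X.sum_coord u
  change u.2 + ∑ i, t i • X.X i u.1 = ∑ i, (X.coord u i + t i) • X.X i u.1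
  rw [← h, ← Finset.sum_add_distrib]
  exact Finset.sum_congr rfl fun i _ => (add_smul _ _ _).symm

theorem translate_zero (u : TM n M) : X.translate 0 u = u := by
  simp [translate]

theorem translate_add (s t : Fin n → ℝ) (u : TM n M) :
    X.translate (s + t) u = X.translate s (X.translate t u) := by
  change (⟨u.1, u.2 + ∑ i, (s i + t i) • X.X i u.1⟩ : TM n M) =
    ⟨u.1, u.2 + ∑ i, t i • X.X i u.1 + ∑ i, s i • X.X i u.1⟩
  rw [add_assoc, ← Finset.sum_add_distrib]
  congr 2
  exact Finset.sum_congr rfl fun i _ => by rw [add_comm (s i)]; exact add_smul _ _ _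

theorem continuousAt_matrix (p : M) (i : Fin n) :
    ContinuousAt (fun q => (trivializationAt (EuclideanSpace ℝ (Fin n)) (TangentSpace (𝓡 n)) p
      (⟨q, X.X i q⟩ : TM n M)).2) p :=
  ((FiberBundle.continuousAt_totalSpace (EuclideanSpace ℝ (Fin n)) _).1
    (X.smooth i).continuous.continuousAt).2

theorem continuous_translate (t : Fin n → ℝ) : Continuous (X.translate t) := by
  rw [continuous_iff_continuousAt]
  intro u
  rw [FiberBundle.continuousAt_totalSpace]
  have hp : Continuous (TotalSpace.proj : TM n M → M) := FiberBundle.continuous_proj _ _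
  refine ⟨hp.continuousAt, ?_⟩
  set e := trivializationAt (EuclideanSpace ℝ (Fin n)) (TangentSpace (𝓡 n) : M → Type _) u.1
    with he
  have h1 : ContinuousAt (fun w : TM n M => (e w).2 + ∑ i, t i • (e ⟨w.1, X.X i w.1⟩).2) u := by
    refine ContinuousAt.add ?_ (tendsto_finsetSum _ fun i _ => ?_)
    · exact ((FiberBundle.continuousAt_totalSpace (EuclideanSpace ℝ (Fin n))
        (fun w : TM n M => w)).1 continuousAt_id).2
    · exact ((X.continuousAt_matrix u.1 i).comp hp.continuousAt).const_smul (t i)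
  refine h1.congr ?_
  have hb : ∀ᶠ w : TM n M in 𝓝 u, w.1 ∈ e.baseSet :=
    hp.continuousAt (e.open_baseSet.mem_nhds (mem_baseSet_trivializationAt _ _ u.1))
  filter_upwards [hb] with w hw
  have hl : ∀ v, (e (⟨w.1, v⟩ : TM n M)).2 = e.continuousLinearEquivAt ℝ w.1 hw v := fun v => rfl
  change (e (⟨w.1, w.2⟩ : TM n M)).2 + _ = (e (⟨w.1, w.2 + ∑ i, t i • X.X i w.1⟩ : TM n M)).2
  simp only [hl, map_add, map_sum, map_smul]

theorem continuous_coord : Continuous X.coord := by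
  rw [continuous_iff_continuousAt]
  intro u
  have hp : Continuous (TotalSpace.proj : TM n M → M) := FiberBundle.continuous_proj _ _
  set e := trivializationAt (EuclideanSpace ℝ (Fin n)) (TangentSpace (𝓡 n) : M → Type _) u.1
    with he
  have hu : u.1 ∈ e.baseSet := mem_baseSet_trivializationAt _ _ u.1
  have hb : ∀ᶠ w : TM n M in 𝓝 u, w.1 ∈ e.baseSet :=
    hp.continuousAt (e.open_baseSet.mem_nhds hu)
  have hl : ∀ q (hq : q ∈ e.baseSet) v,
    (e (⟨q, v⟩ : TM n M)).2 = e.continuousLinearEquivAt ℝ q hq v := fun q hq v => rfl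
  let A : M → Matrix (Fin n) (Fin n) ℝ := fun q =>
    Matrix.of fun j i => (e (⟨q, X.X i q⟩ : TM n M)).2 j
  have hA : ∀ q ∈ e.baseSet, ∀ t : Fin n → ℝ,
      A q *ᵥ t = (e (⟨q, ∑ i, t i • X.X i q⟩ : TM n M)).2 := by
    intro q hq t
    have hs : (e (⟨q, ∑ i, t i • X.X i q⟩ : TM n M)).2 =
        ∑ i, t i • (e (⟨q, X.X i q⟩ : TM n M)).2 := by
      simp only [hl q hq, map_sum, map_smul]
    rw [hs]
    ext j
    rw [WithLp.ofLp_sum, Finset.sum_apply]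
    change ∑ i, A q j i * t i = ∑ i, t i * A q j i
    exact Finset.sum_congr rfl fun i _ => mul_comm (A q j i) (t i)
  have hunit : ∀ q ∈ e.baseSet, IsUnit (A q) := by
    intro q hq
    rw [← Matrix.mulVec_injective_iff_isUnit]
    intro s t hst
    have h1 : A q *ᵥ s = A q *ᵥ t := hst
    rw [hA q hq, hA q hq, hl q hq, hl q hq] at h1
    have h2 := (e.continuousLinearEquivAt ℝ q hq).injective (WithLp.ofLp_injective 2 h1)
    rw [← X.eq_coord (u := (⟨q, ∑ i, s i • X.X i q⟩ : TM n M)) rfl,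
      ← X.eq_coord (u := (⟨q, ∑ i, t i • X.X i q⟩ : TM n M)) rfl, h2]
  have hAc : ContinuousAt A u.1 := by
    refine continuousAt_pi.2 fun j => continuousAt_pi.2 fun i => ?_
    exact (EuclideanSpace.proj (𝕜 := ℝ) j).continuous.continuousAt.comp (X.continuousAt_matrix u.1 i)
  have hinv : ContinuousAt (fun w : TM n M => (A w.1)⁻¹) u := by
    have hAu : ContinuousAt (fun w : TM n M => A w.1) u :=
      ContinuousAt.comp (f := (TotalSpace.proj : TM n M → M)) hAc hp.continuousAt
    have hd : (A u.1).det ≠ 0 := ((Matrix.isUnit_iff_isUnit_det _).1 (hunit _ hu)).ne_zero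
    simp only [Matrix.inv_def, Ring.inverse_eq_inv']
    refine ContinuousAt.smul (f := fun w : TM n M => (A w.1).det⁻¹)
      (g := fun w : TM n M => (A w.1).adjugate) (ContinuousAt.inv₀ ?_ hd) ?_
    · exact (Continuous.matrix_det continuous_id).continuousAt.comp hAu
    · exact (Continuous.matrix_adjugate continuous_id).continuousAt.comp hAu
  have hv : ContinuousAt (fun w : TM n M => ((e w).2 : Fin n → ℝ)) u :=
    (PiLp.continuous_ofLp 2 _).continuousAt.comp
      ((FiberBundle.continuousAt_totalSpace (EuclideanSpace ℝ (Fin n))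
        (fun w : TM n M => w)).1 continuousAt_id).2
  have h1 : ContinuousAt (fun w : TM n M => (A w.1)⁻¹ *ᵥ ((e w).2 : Fin n → ℝ)) u := by
    have hm : Continuous fun z : Matrix (Fin n) (Fin n) ℝ × (Fin n → ℝ) => z.1 *ᵥ z.2 :=
      Continuous.matrix_mulVec continuous_fst continuous_snd
    exact hm.continuousAt.comp (hinv.prodMk hv)
  refine h1.congr ?_
  filter_upwards [hb] with w hw
  have h2 : ((e w).2 : Fin n → ℝ) = A w.1 *ᵥ X.coord w := by
    rw [hA w.1 hw, X.sum_coord]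
  rw [h2, Matrix.mulVec_mulVec, Matrix.nonsing_inv_mul _
    ((Matrix.isUnit_iff_isUnit_det _).1 (hunit _ hw)), Matrix.one_mulVec]

/-! ### The quotient manifold `M_L = TM / Γ(L)` -/

/-- The group `Γ(L) ≅ ℤⁿ` of transformations `u ↦ u + k₁ X₁ + ⋯ + kₙ Xₙ` of `TM`, `k ∈ ℤⁿ`. -/
def deckGroup : Subgroup (Equiv.Perm (TM n M)) where
  carrier := {γ | ∃ k : Fin n → ℤ, ∀ u, γ u = X.translate (fun i => (k i : ℝ)) u}
  one_mem' := ⟨0, fun u => by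
    refine (X.translate_zero u).symm.trans ?_
    congr 1
    ext i
    simp⟩
  mul_mem' := by
    rintro γ δ ⟨k, hk⟩ ⟨l, hl⟩
    refine ⟨k + l, fun u => ?_⟩
    rw [Equiv.Perm.mul_apply, hl, hk, ← X.translate_add]
    congr 1
    ext i
    simp
  inv_mem' := by
    rintro γ ⟨k, hk⟩
    refine ⟨-k, fun u => ?_⟩
    rw [Equiv.Perm.inv_eq_iff_eq, hk, ← X.translate_add]
    refine (X.translate_zero u).symm.trans ?_
    congr 1
    ext i
    simp

/-- The space `M_L = TM / Γ(L)`. -/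
def ML : Type _ := MulAction.orbitRel.Quotient X.deckGroup (TM n M)

/-- `M_L` carries the quotient topology. -/
instance : TopologicalSpace X.ML :=
  inferInstanceAs (TopologicalSpace (Quotient (MulAction.orbitRel X.deckGroup (TM n M))))

/-- The quotient map `q_L : TM → M_L`. -/
def q : TM n M → X.ML := Quotient.mk (MulAction.orbitRel X.deckGroup (TM n M))

theorem q_eq_iff {u v : TM n M} :
    X.q u = X.q v ↔ ∃ k : Fin n → ℤ, u = X.translate (fun i => (k i : ℝ)) v := by
  refine Quotient.eq''.trans ?_
  rw [MulAction.orbitRel_apply]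
  constructor
  · rintro ⟨⟨γ, k, hk⟩, rfl⟩
    exact ⟨k, hk v⟩
  · rintro ⟨k, rfl⟩
    have hinv : ∀ s : Fin n → ℝ, ∀ w, X.translate (-s) (X.translate s w) = w := fun s w => by
      rw [← X.translate_add, neg_add_cancel, X.translate_zero]
    refine ⟨⟨⟨X.translate (fun i => (k i : ℝ)), X.translate (-fun i => (k i : ℝ)), hinv _,
      fun w => ?_⟩, k, fun w => rfl⟩, rfl⟩
    simpa using hinv (-fun i => (k i : ℝ)) w

/-- `q_L` is a covering map with deck transformation group `Γ(L)`. -/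
theorem isQuotientCoveringMap_q : IsQuotientCoveringMap X.q X.deckGroup where
  toIsQuotientMap := isQuotientMap_quotient_mk'
  continuous_const_smul := by
    rintro ⟨γ, k, hk⟩
    exact (X.continuous_translate _).congr fun u => (hk u).symm
  apply_eq_iff_mem_orbit := Quotient.eq''
  disjoint u := by
    refine ⟨X.coord ⁻¹' Metric.ball (X.coord u) (1 / 2),
      X.continuous_coord.continuousAt (Metric.ball_mem_nhds _ (by norm_num)), ?_⟩
    rintro ⟨γ, k, hk⟩ ⟨_, ⟨w, hw, rfl⟩, hw'⟩
    have hk0 : k = 0 := by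
      ext i
      have h1 : X.coord (γ w) = X.coord w + fun i => (k i : ℝ) := by
        rw [hk, X.coord_translate]
      have h2 : dist (X.coord (γ w)) (X.coord w) < 1 := by
        have h3 : dist (X.coord (γ w)) (X.coord u) < 1 / 2 := hw'
        have h4 : dist (X.coord w) (X.coord u) < 1 / 2 := hw
        linarith [dist_triangle_right (X.coord (γ w)) (X.coord w) (X.coord u)]
      have h5 := (dist_pi_lt_iff one_pos).1 h2 i
      rw [h1, Pi.add_apply, dist_self_add_left, Real.norm_eq_abs] at h5
      have h6 : |k i| < 1 := by exact_mod_cast h5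
      rwa [Int.abs_lt_one_iff] at h6
    apply Subtype.ext
    ext1 w'
    change γ w' = w'
    rw [hk, hk0]
    refine Eq.trans ?_ (X.translate_zero w')
    congr 1
    ext i
    simp

/-- The manifold structure of `M_L`: the charts are the charts of `TM` composed with local
inverses of the covering map `q_L`. -/
instance : ChartedSpace (ModelProd (EuclideanSpace ℝ (Fin n)) (EuclideanSpace ℝ (Fin n))) X.ML :=
  X.isQuotientCoveringMap_q.isCoveringMap.isLocalHomeomorph.chartedSpace
    X.isQuotientCoveringMap_q.surjective

/-- The derivative of `q_L` at `u`. -/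
def dq (u : TM n M) :
    TangentSpace (𝓡 n).tangent u →L[ℝ] TangentSpace (𝓡 n).tangent (X.q u) :=
  mfderiv (𝓡 n).tangent (𝓡 n).tangent X.q u

/-- A point of `TM` above a given point of `M_L`. -/
def lift (x : X.ML) : TM n M := Quotient.out x

theorem q_lift (x : X.ML) : X.q (X.lift x) = x := Quotient.out_eq x

/-- The derivative of `q_L` at the chosen lift of `x`, as a map into `T_x(M_L)`. -/
def dqLift (x : X.ML) :
    TangentSpace (𝓡 n).tangent (X.lift x) →L[ℝ] TangentSpace (𝓡 n).tangent x :=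
  X.dq (X.lift x)

/-- The metric of `M_L`: the metric of `TM` transported by the local diffeomorphism `q_L` (this
does not depend on the lift, since `Γ(L)` acts by isometries). -/
def metric (h : Metric n M) (x : X.ML) (v w : TangentSpace (𝓡 n).tangent x) : ℝ :=
  tangentMetric h cov (X.lift x) ((X.dqLift x).inverse v) ((X.dqLift x).inverse w)

/-- The complex structure of `M_L`: that of `TM` transported by `q_L`. -/
def J (x : X.ML) (v : TangentSpace (𝓡 n).tangent x) : TangentSpace (𝓡 n).tangent x :=
  X.dqLift x (tangentJ cov (X.lift x) ((X.dqLift x).inverse v))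

/-- `q_L : TM → M_L` is a Kähler covering map: a covering map which is a local diffeomorphism,
isometric and holomorphic. -/
structure IsKahlerCovering (h : Metric n M) : Prop where
  covering : IsCoveringMap X.q
  localDiffeo : IsLocalDiffeomorph (𝓡 n).tangent (𝓡 n).tangent ∞ X.q
  isometric : ∀ u A B, X.metric h (X.q u) (X.dq u A) (X.dq u B) = tangentMetric h cov u A B
  holomorphic : ∀ u A, X.J (X.q u) (X.dq u A) = X.dq u (tangentJ cov u A)

/-- The torus action `Φ([t], q_L(u)) = q_L(u + t₁ X₁ + ⋯ + tₙ Xₙ)` on `M_L`. -/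
def torusAction (a : Torus n) (x : X.ML) : X.ML :=
  Quotient.liftOn₂' a x (fun t u => X.q (X.translate t u)) (by
    intro t u t' u' ht hu
    obtain ⟨k, hk⟩ := QuotientAddGroup.leftRel_apply.1 ht
    obtain ⟨l, rfl⟩ := X.q_eq_iff.1 (Quotient.sound' hu)
    rw [X.q_eq_iff]
    refine ⟨l - k, ?_⟩
    rw [← X.translate_add, ← X.translate_add]
    congr 1
    have : t' = t + fun i => (k i : ℝ) := by rw [← hk]; abel
    rw [this]
    ext i
    simp [add_comm])

@[simp]
theorem torusAction_mk (t : Fin n → ℝ) (u : TM n M) :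
    X.torusAction (Torus.mk t) (X.q u) = X.q (X.translate t u) := rfl

/-! ### The groups -/

end ParallelFrame

section Perm

variable {E H N : Type*} [NormedAddCommGroup E] [NormedSpace ℝ E] [TopologicalSpace H]
  {I : ModelWithCorners ℝ E H} [TopologicalSpace N] [ChartedSpace H N]

theorem mfderiv_perm_mul {φ ψ : Equiv.Perm N} (hφ : ContMDiff I I ∞ φ) (hψ : ContMDiff I I ∞ ψ)
    (p : N) (v : TangentSpace I p) :
    mfderiv I I (φ * ψ : Equiv.Perm N) p v = mfderiv I I φ (ψ p) (mfderiv I I ψ p v) := by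
  have h := mfderiv_comp p (hφ.mdifferentiableAt (by simp) (x := ψ p))
    (hψ.mdifferentiableAt (by simp))
  exact congrArg (fun L => L v) h

theorem mfderiv_perm_one (p : N) (v : TangentSpace I p) :
    mfderiv I I (1 : Equiv.Perm N) p v = v :=
  congrArg (fun L => L v) (mfderiv_id (I := I) (x := p))

theorem mfderiv_perm_symm {ψ : Equiv.Perm N} (hψ : ContMDiff I I ∞ ψ)
    (hψ' : ContMDiff I I ∞ ψ.symm) (p : N) (v : TangentSpace I p) :
    mfderiv I I ψ (ψ.symm p) (mfderiv I I ψ.symm p v) = v := by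
  have h := mfderiv_perm_mul hψ hψ' p v
  have h1 : (ψ * ψ.symm : Equiv.Perm N) = 1 := mul_inv_cancel ψ
  rw [h1] at h
  exact h.symm.trans (mfderiv_perm_one p v)

/-- If `ψ` preserves a family of functions of two tangent vectors, so does its inverse. -/
theorem preserves_symm {ψ : Equiv.Perm N} (hψ : ContMDiff I I ∞ ψ)
    (hψ' : ContMDiff I I ∞ ψ.symm) (B : (p : N) → TangentSpace I p → TangentSpace I p → ℝ)
    (hB : ∀ p v w, B (ψ p) (mfderiv I I ψ p v) (mfderiv I I ψ p w) = B p v w)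
    (p : N) (v w : TangentSpace I p) :
    B (ψ.symm p) (mfderiv I I ψ.symm p v) (mfderiv I I ψ.symm p w) = B p v w := by
  have hc : ∀ r (_ : r = p) (v' w' : E), B r v' w' = B p v' w' := by
    rintro _ rfl _ _
    rfl
  have h := hB (ψ.symm p) (mfderiv I I ψ.symm p v) (mfderiv I I ψ.symm p w)
  rw [mfderiv_perm_symm hψ hψ', mfderiv_perm_symm hψ hψ'] at h
  exact h.symm.trans (hc _ (ψ.apply_symm_apply p) v w)

/-- If the derivative of `ψ` commutes with a family of maps of tangent spaces, so does the
derivative of its inverse. -/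
theorem commutes_symm {ψ : Equiv.Perm N} (hψ : ContMDiff I I ∞ ψ)
    (hψ' : ContMDiff I I ∞ ψ.symm) (J : (p : N) → TangentSpace I p → TangentSpace I p)
    (hJ : ∀ p v, mfderiv I I ψ p (J p v) = J (ψ p) (mfderiv I I ψ p v))
    (p : N) (v : TangentSpace I p) :
    mfderiv I I ψ.symm p (J p v) = J (ψ.symm p) (mfderiv I I ψ.symm p v) := by
  have hc : ∀ r (_ : r = p) (v' : E), J r v' = (J p v' : E) := by
    rintro _ rfl _
    rfl
  have h := hJ (ψ.symm p) (mfderiv I I ψ.symm p v)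
  rw [mfderiv_perm_symm hψ hψ'] at h
  have h1 : mfderiv I I ψ (ψ.symm p) (J (ψ.symm p) (mfderiv I I ψ.symm p v)) = (J p v : E) :=
    h.trans (hc _ (ψ.apply_symm_apply p) v)
  have h2 := mfderiv_perm_symm hψ' hψ (ψ.symm p) (J (ψ.symm p) (mfderiv I I ψ.symm p v))
  rw [← h2]
  have hd : ∀ r (_ : r = p) (v' : E), mfderiv I I ψ.symm r v' = (mfderiv I I ψ.symm p v' : E) := by
    rintro _ rfl _
    rfl
  refine Eq.trans ?_ (hd _ (ψ.apply_symm_apply p) _).symm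
  exact congrArg (fun z : E => (mfderiv I I ψ.symm p z : E)) h1.symm

end Perm

/-- The group of diffeomorphisms of `M`. -/
def diffGroup (n : ℕ) (M : Type*) [TopologicalSpace M]
    [ChartedSpace (EuclideanSpace ℝ (Fin n)) M] : Subgroup (Equiv.Perm M) where
  carrier := {ψ | ContMDiff (𝓡 n) (𝓡 n) ∞ ψ ∧ ContMDiff (𝓡 n) (𝓡 n) ∞ ψ.symm}
  one_mem' := ⟨contMDiff_id, contMDiff_id⟩
  mul_mem' := fun hφ hψ => ⟨hφ.1.comp hψ.1, hψ.2.comp hφ.2⟩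
  inv_mem' := fun hψ => ⟨hψ.2, hψ.1⟩

/-- The group `Isom(M, h)` of isometries of `(M, h)`. -/
def isomGroup (h : Metric n M) : Subgroup (Equiv.Perm M) where
  carrier := {ψ | ψ ∈ diffGroup n M ∧ ∀ p (v w : TangentSpace (𝓡 n) p),
    h.inner (ψ p) (mfderiv (𝓡 n) (𝓡 n) ψ p v) (mfderiv (𝓡 n) (𝓡 n) ψ p w) = h.inner p v w}
  one_mem' := ⟨one_mem _, fun p v w => by
    rw [mfderiv_perm_one, mfderiv_perm_one]
    rfl⟩
  mul_mem' := by
    rintro φ ψ ⟨hφ, hφ'⟩ ⟨hψ, hψ'⟩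
    refine ⟨mul_mem hφ hψ, fun p v w => ?_⟩
    rw [mfderiv_perm_mul hφ.1 hψ.1, mfderiv_perm_mul hφ.1 hψ.1]
    exact (hφ' _ _ _).trans (hψ' _ _ _)
  inv_mem' := by
    rintro ψ ⟨hψ, hψ'⟩
    exact ⟨inv_mem hψ, preserves_symm hψ.1 hψ.2 (fun p v w => h.inner p v w) hψ'⟩

theorem tangentMap_symm {ψ : Equiv.Perm M} (hψ : ψ ∈ diffGroup n M) (u : TM n M) :
    tangentMap (𝓡 n) (𝓡 n) ψ.symm (tangentMap (𝓡 n) (𝓡 n) ψ u) = u := by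
  have h := tangentMap_comp (I := 𝓡 n) (I' := 𝓡 n) (I'' := 𝓡 n) (g := ψ.symm) (f := ψ)
    (hψ.2.mdifferentiable (by simp)) (hψ.1.mdifferentiable (by simp))
  have h1 : (ψ.symm ∘ ψ : M → M) = id := ψ.symm_comp_self
  rw [h1, tangentMap_id] at h
  exact (congrFun h u).symm

namespace ParallelFrame

variable {cov : AffineConnection n M} (X : ParallelFrame cov)

/-- The group `Diff(M, L)` of diffeomorphisms `ψ` of `M` with `ψ_*(L) = L`. -/
def diffL : Subgroup (Equiv.Perm M) where
  carrier := {ψ | ψ ∈ diffGroup n M ∧ tangentMap (𝓡 n) (𝓡 n) ψ '' X.lattice = X.lattice}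
  one_mem' := ⟨one_mem _, by
    change tangentMap (𝓡 n) (𝓡 n) id '' X.lattice = X.lattice
    rw [tangentMap_id, image_id]⟩
  mul_mem' := by
    rintro φ ψ ⟨hφ, hφ'⟩ ⟨hψ, hψ'⟩
    refine ⟨mul_mem hφ hψ, ?_⟩
    change tangentMap (𝓡 n) (𝓡 n) (φ ∘ ψ) '' X.lattice = X.lattice
    rw [tangentMap_comp (hφ.1.mdifferentiable (by simp)) (hψ.1.mdifferentiable (by simp)),
      image_comp, hψ', hφ']
  inv_mem' := by
    rintro ψ ⟨hψ, hψ'⟩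
    refine ⟨inv_mem hψ, ?_⟩
    change tangentMap (𝓡 n) (𝓡 n) ψ.symm '' X.lattice = X.lattice
    conv_lhs => rw [← hψ', ← image_comp]
    rw [show tangentMap (𝓡 n) (𝓡 n) ψ.symm ∘ tangentMap (𝓡 n) (𝓡 n) ψ = id from
      funext (tangentMap_symm hψ), image_id]

/-- The group `Diff(M, h, L) = Diff(M, L) ∩ Isom(M, h)`. -/
def diffhL (h : Metric n M) : Subgroup (Equiv.Perm M) := X.diffL ⊓ isomGroup h

theorem exists_rotation [ConnectedSpace M] {ψ : Equiv.Perm M} (hψ : ψ ∈ X.diffL) :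
    ∃ R : Matrix (Fin n) (Fin n) ℤ, ∀ p k,
      mfderiv (𝓡 n) (𝓡 n) ψ p (X.X k p) = ∑ i, (R i k : ℝ) • X.X i (ψ p) := by
  let c : Fin n → M → Fin n → ℝ := fun k p =>
    X.coord (tangentMap (𝓡 n) (𝓡 n) ψ ⟨p, X.X k p⟩)
  have hc : ∀ k, Continuous (c k) := fun k =>
    X.continuous_coord.comp
      ((hψ.1.1.continuous_tangentMap (by simp)).comp (X.smooth k).continuous)
  have hmem : ∀ k p, (⟨p, X.X k p⟩ : TM n M) ∈ X.lattice := by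
    classical
    intro k p
    refine ⟨Pi.single k 1, ?_⟩
    rw [Finset.sum_eq_single k]
    · simp
    · intro i _ hi
      rw [Pi.single_eq_of_ne hi]
      exact zero_smul ℤ _
    · simp
  have hint : ∀ k p, ∃ l : Fin n → ℤ, c k p = fun i => (l i : ℝ) := by
    intro k p
    have h1 : tangentMap (𝓡 n) (𝓡 n) ψ ⟨p, X.X k p⟩ ∈ X.lattice := by
      rw [← hψ.2]
      exact mem_image_of_mem _ (hmem k p)
    obtain ⟨l, hl⟩ := h1
    refine ⟨l, X.eq_coord (hl.trans ?_)⟩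
    exact Finset.sum_congr rfl fun i _ => (Int.cast_smul_eq_zsmul ℝ _ _).symm
  have hconst : ∀ k p p', c k p = c k p' := by
    intro k p p'
    exact isPreconnected_univ.constant_of_mapsTo (isDiscrete_intLattice n) (hc k).continuousOn
      (fun p _ => hint k p) (mem_univ p) (mem_univ p')
  obtain ⟨p₀⟩ : Nonempty M := inferInstance
  choose R hR using fun k => hint k p₀
  refine ⟨fun i k => R k i, fun p k => ?_⟩
  have h1 := X.sum_coord (tangentMap (𝓡 n) (𝓡 n) ψ ⟨p, X.X k p⟩)
  have h2 : X.coord (tangentMap (𝓡 n) (𝓡 n) ψ ⟨p, X.X k p⟩) = fun i => (R k i : ℝ) :=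
    (hconst k p p₀).trans (hR k)
  rw [h2] at h1
  exact h1.symm

theorem rotation_unique [ConnectedSpace M] {R S : Matrix (Fin n) (Fin n) ℤ} {p : M}
    (h : ∀ k, ∑ i, (R i k : ℝ) • X.X i p = ∑ i, (S i k : ℝ) • X.X i p) : R = S := by
  ext i k
  have h1 := X.eq_coord (u := (⟨p, ∑ i, (R i k : ℝ) • X.X i p⟩ : TM n M))
    (t := fun i => (R i k : ℝ)) rfl
  have h2 := X.eq_coord (u := (⟨p, ∑ i, (R i k : ℝ) • X.X i p⟩ : TM n M))
    (t := fun i => (S i k : ℝ)) (h k)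
  exact_mod_cast congrFun (h1.symm.trans h2) i

/-- The matrix `R(ψ)` such that `ψ_* X_k(p) = ∑ᵢ R(ψ)ᵢₖ Xᵢ(ψ(p))` for all `p` and `k`. -/
def rotation [ConnectedSpace M] (h : Metric n M) (ψ : X.diffhL h) : Matrix (Fin n) (Fin n) ℤ :=
  (X.exists_rotation ψ.2.1).choose

theorem rotation_spec [ConnectedSpace M] (h : Metric n M) (ψ : X.diffhL h) (p : M) (k : Fin n) :
    mfderiv (𝓡 n) (𝓡 n) (ψ : Equiv.Perm M) p (X.X k p) =
      ∑ i, (X.rotation h ψ i k : ℝ) • X.X i ((ψ : Equiv.Perm M) p) :=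
  (X.exists_rotation ψ.2.1).choose_spec p k

/-- The homomorphism `Diff(M, h, L) → GL(n, ℤ)`, `ψ ↦ R(ψ)`. -/
def rotationHom [ConnectedSpace M] (h : Metric n M) : X.diffhL h →* GL (Fin n) ℤ :=
  MonoidHom.toHomUnits
    { toFun := X.rotation h
      map_one' := by
        obtain ⟨p⟩ : Nonempty M := inferInstance
        refine X.rotation_unique (p := p) fun k => ?_
        have h1 := X.rotation_spec h 1 p k
        rw [show ((1 : X.diffhL h) : Equiv.Perm M) = 1 from rfl, mfderiv_perm_one] at h1
        refine h1.symm.trans ?_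
        rw [Finset.sum_eq_single k]
        · simp
        · intro i _ hi
          rw [Matrix.one_apply_ne hi, Int.cast_zero]
          exact zero_smul ℝ _
        · simp
      map_mul' := by
        intro φ ψ
        obtain ⟨p⟩ : Nonempty M := inferInstance
        refine X.rotation_unique (p := (φ : Equiv.Perm M) ((ψ : Equiv.Perm M) p)) fun k => ?_
        have h1 := X.rotation_spec h (φ * ψ) p k
        rw [show ((φ * ψ : X.diffhL h) : Equiv.Perm M) = φ * ψ from rfl,
          mfderiv_perm_mul φ.2.1.1.1 ψ.2.1.1.1, X.rotation_spec h ψ, map_sum] at h1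
        refine h1.symm.trans ?_
        simp only [map_smul, X.rotation_spec h φ, Finset.smul_sum, Matrix.mul_apply]
        rw [Finset.sum_comm]
        refine Finset.sum_congr rfl fun i _ => ?_
        rw [Int.cast_sum, Finset.sum_smul]
        refine Finset.sum_congr rfl fun j _ => ?_
        rw [smul_smul, Int.cast_mul, mul_comm] }

/-- The semidirect product `𝕋ⁿ ⋊ Diff(M, h, L)`, with multiplication
`(a, ψ) (a', ψ') = (ρ_{R(ψ)}(a') a, ψ ∘ ψ')`. -/
abbrev semidirect [ConnectedSpace M] (h : Metric n M) : Type _ :=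
  Multiplicative (Torus n) ⋊[(torusAut n).comp (X.rotationHom h)] X.diffhL h

/-- The group `Aut(M_L, g)^{𝕋ⁿ}` of holomorphic isometries `φ` of `M_L` which are equivariant: there
is a Lie group isomorphism `ρ` of `𝕋ⁿ` such that `φ ∘ Φ_a = Φ_{ρ(a)} ∘ φ` for all `a ∈ 𝕋ⁿ`. -/
def autML (h : Metric n M) : Subgroup (Equiv.Perm X.ML) where
  carrier := {φ |
    ContMDiff (𝓡 n).tangent (𝓡 n).tangent ∞ φ ∧ ContMDiff (𝓡 n).tangent (𝓡 n).tangent ∞ φ.symm ∧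
    (∀ x (v w : TangentSpace (𝓡 n).tangent x),
      X.metric h (φ x) (mfderiv (𝓡 n).tangent (𝓡 n).tangent φ x v)
        (mfderiv (𝓡 n).tangent (𝓡 n).tangent φ x w) = X.metric h x v w) ∧
    (∀ x (v : TangentSpace (𝓡 n).tangent x),
      mfderiv (𝓡 n).tangent (𝓡 n).tangent φ x (X.J x v) =
        X.J (φ x) (mfderiv (𝓡 n).tangent (𝓡 n).tangent φ x v)) ∧
    ∃ ρ : Torus n ≃+ Torus n, IsLieGroupIso ρ ∧
      ∀ a x, φ (X.torusAction a x) = X.torusAction (ρ a) (φ x)}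
  one_mem' := by
    refine ⟨contMDiff_id, contMDiff_id, fun x v w => ?_, fun x v => ?_, AddEquiv.refl _,
      ⟨contMDiff_id, contMDiff_id⟩, fun a x => rfl⟩
    · rw [mfderiv_perm_one, mfderiv_perm_one]
      rfl
    · rw [mfderiv_perm_one, mfderiv_perm_one]
      rfl
  mul_mem' := by
    rintro φ ψ ⟨hφ, hφ', hφg, hφJ, ρ, hρ, hφρ⟩ ⟨hψ, hψ', hψg, hψJ, σ, hσ, hψσ⟩
    refine ⟨hφ.comp hψ, hψ'.comp hφ', fun x v w => ?_, fun x v => ?_, σ.trans ρ,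
      ⟨hρ.1.comp hσ.1, hσ.2.comp hρ.2⟩, fun a x => ?_⟩
    · rw [mfderiv_perm_mul hφ hψ, mfderiv_perm_mul hφ hψ]
      exact (hφg _ _ _).trans (hψg _ _ _)
    · rw [mfderiv_perm_mul hφ hψ, mfderiv_perm_mul hφ hψ, hψJ]
      exact hφJ _ _
    · change φ (ψ _) = _
      rw [hψσ, hφρ]
      rfl
  inv_mem' := by
    rintro φ ⟨hφ, hφ', hφg, hφJ, ρ, hρ, hφρ⟩
    refine ⟨hφ', hφ, preserves_symm hφ hφ' (X.metric h) hφg,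
      commutes_symm hφ hφ' X.J hφJ, ρ.symm, ⟨hρ.2, hρ.1⟩, fun a x => ?_⟩
    change φ.symm _ = X.torusAction _ (φ.symm x)
    rw [Equiv.symm_apply_eq, hφρ, AddEquiv.apply_symm_apply, Equiv.apply_symm_apply]

end ParallelFrame

end Manifold

end DuallyFlat

end

/-!
The parallel frame `X` identifies `TM` with `M × ℝⁿ` through `u ↦ (π(u), coord u)`, and therefore
`M_L` with `M × 𝕋ⁿ`. The main computation is `ParallelFrame.connector_eq`: since the sections
`∑ᵢ cᵢ Xᵢ` with constant `c` are parallel, the connector is `K A = ∑ᵢ d(coordᵢ)(A) Xᵢ`. So a map of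
`TM` that covers `ψ : M → M` and acts by an affine map `c ↦ R c + t` in the fibre coordinates, where
`ψ_* Xₖ = ∑ᵢ Rᵢₖ Xᵢ`, has a derivative which acts as `ψ_* × ψ_*` in the splitting of `T(TM)`
(`IsSplitMap`); such maps commute with `J`, and they are isometric as soon as `ψ` is.

Applied to the translations by `ℤⁿ` (with `ψ = id`), this shows that the Kähler structure descends
to `M_L`. Applied to `u ↦ ψ_* u + ∑ᵢ tᵢ Xᵢ`, it shows that the formula for `Γ` defines elements of
`Aut(M_L, g)^{𝕋ⁿ}`. Injectivity holds because the torus acts freely on the fibres of `M_L → M`.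

For surjectivity let `φ` be an equivariant holomorphic isometry. The automorphism of `𝕋ⁿ` that
belongs to it is given by an integer matrix `A` (`exists_eq_torusEnd`, by lifting to the universal
covering `ℝⁿ`), and `φ` induces a diffeomorphism `ψ` of the orbit space `M`. By equivariance the
derivative of `φ` acts on the vertical vectors by `A`; as `J` exchanges vertical and horizontal
vectors, it also acts by `A` on the horizontal ones, and it preserves the horizontal distribution
(`IsHolomorphicEquivariant.mfderiv_lift_horizontal`). Consequently `ψ_* Xₖ = ∑ᵢ Aᵢₖ Xᵢ`, `ψ` is an
isometry preserving `L`, and the fibre coordinate of `φ` along the zero section has derivative zero,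
so it is a constant `a` because `M` is connected. Hence `φ = Γ_{(a, ψ)}`.
-/

noncomputable section

namespace DuallyFlat

/-! ### Quotients by local homeomorphisms as smooth manifolds -/

section LocalDiffeo

variable {E H N N' : Type*} [NormedAddCommGroup E] [NormedSpace ℝ E] [TopologicalSpace H]
  {I : ModelWithCorners ℝ E H} [TopologicalSpace N] [ChartedSpace H N] [TopologicalSpace N']
  {f : N → N'} {g : N' → N} {k : ℕ∞ω}

/-- A germ `τ` that preserves `f` and maps `u` to `v` is the local inverse of `f` at `v` composed
with `f`. -/
theorem eventually_localInverseAt_apply (hf : IsLocalHomeomorph f) {u v : N} {τ : N → N}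
    (hτ : ContinuousAt τ u) (huv : τ u = v) (hfτ : ∀ᶠ w in 𝓝 u, f (τ w) = f w) :
    ∀ᶠ w in 𝓝 u, hf.localInverseAt v (f w) = τ w := by
  have h1 : ∀ᶠ w in 𝓝 u, τ w ∈ (hf.localInverseAt v).target := by
    apply hτ
    rw [huv]
    exact (hf.localInverseAt v).open_target.mem_nhds hf.self_mem_localInverseAt_target
  filter_upwards [h1, hfτ] with w hw hw'
  have h2 := (hf.localInverseAt v).right_inv hw
  rw [hf.localInverseAt_symm, hw'] at h2
  exact h2

/-- Let `f` be a local homeomorphism whose target carries the charts `chart ∘ (local inverse)`. If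
any two points of a fibre of `f` are exchanged by a germ of a `C^k` map that preserves `f`, then
`f` is a local diffeomorphism: in the charts, `f` and its local inverses are such germs. -/
theorem isLocalDiffeomorph_chartedSpaceOfRightInverse (hf : IsLocalHomeomorph f)
    (hg : Function.RightInverse g f)
    (hτ : ∀ u v, f u = f v → ∃ τ : N → N, ContMDiffAt I I k τ u ∧ τ u = v ∧
      ∀ᶠ w in 𝓝 u, f (τ w) = f w) :
    letI := hf.chartedSpaceOfRightInverse (H := H) hg
    IsLocalDiffeomorph I I k f := by
  let _ := hf.chartedSpaceOfRightInverse (H := H) hg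
  have hto : ∀ (x : N') y, extChartAt I x y = extChartAt I (g x) (hf.localInverseAt (g x) y) :=
    fun x y => rfl
  have hinv : ∀ (x : N') z, (extChartAt I x).symm z = f ((extChartAt I (g x)).symm z) := by
    intro x z
    change (hf.localInverseAt (g x)).symm ((extChartAt I (g x)).symm z) = _
    rw [hf.localInverseAt_symm]
  have hev : ∀ (u : N) {P : N → Prop}, (∀ᶠ w in 𝓝 u, P w) →
      ∀ᶠ z in 𝓝[range I] (extChartAt I u u), P ((extChartAt I u).symm z) := by
    intro u P hP
    refine nhdsWithin_le_nhds ((continuousAt_extChartAt_symm u).eventually ?_)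
    rwa [extChartAt_to_inv]
  -- In the charts, `f` near `u` is the germ `τ` that moves `u` to the chosen lift `g (f u)`.
  have hsm : ∀ u, ContMDiffAt I I k f u := by
    intro u
    obtain ⟨τ, hτs, hτu, hτf⟩ := hτ u (g (f u)) (hg (f u)).symm
    refine contMDiffAt_iff.2 ⟨hf.continuous.continuousAt, ?_⟩
    have h1 := (contMDiffAt_iff.1 hτs).2
    rw [hτu] at h1
    have h2 := eventually_localInverseAt_apply hf hτs.continuousAt hτu hτf
    refine h1.congr_of_eventuallyEq ?_ ?_
    · filter_upwards [hev u h2] with z hz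
      simp only [Function.comp, hto, hz]
    · simp only [Function.comp, extChartAt_to_inv, hto, hτu, h2.self_of_nhds]
  -- In the charts, the local inverse at `v` is the germ that moves `g (f v)` to `v`.
  have hsi : ∀ v, ContMDiffAt I I k (hf.localInverseAt v) (f v) := by
    intro v
    obtain ⟨τ, hτs, hτu, hτf⟩ := hτ (g (f v)) v (hg (f v))
    refine contMDiffAt_iff.2 ⟨(hf.localInverseAt v).continuousAt
      hf.apply_self_mem_localInverseAt_source, ?_⟩
    have h1 := (contMDiffAt_iff.1 hτs).2
    have h2 := eventually_localInverseAt_apply hf hτs.continuousAt hτu hτf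
    have h3 : extChartAt I (f v) (f v) = extChartAt I (g (f v)) (g (f v)) := by
      rw [hto]
      congr 1
      conv_lhs => rw [← hg (f v)]
      rw [hg (f v)]
      have := hf.localInverseAt_apply_self (x := g (f v))
      rwa [hg (f v)] at this
    rw [hf.localInverseAt_apply_self, h3]
    rw [hτu] at h1
    refine h1.congr_of_eventuallyEq ?_ ?_
    · filter_upwards [hev _ h2] with z hz
      simp only [Function.comp, hinv, hz]
    · simp only [Function.comp, extChartAt_to_inv, hinv, h2.self_of_nhds]
  intro u
  let L := hf.localInverseAt u
  refine ⟨{ toPartialEquiv := L.symm.toPartialEquiv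
            open_source := L.open_target
            open_target := L.open_source
            contMDiffOn_toFun := ?_
            contMDiffOn_invFun := ?_ }, hf.self_mem_localInverseAt_target, ?_⟩
  · intro v _
    change ContMDiffWithinAt I I k L.symm _ v
    rw [hf.localInverseAt_symm]
    exact (hsm v).contMDiffWithinAt
  · intro y hy
    change y ∈ L.source at hy
    change ContMDiffWithinAt I I k L L.source y
    have hfy : f (L y) = y := hf.apply_localInverseAt_of_mem hy
    have h1 := hsi (L y)
    rw [hfy] at h1
    refine (h1.congr_of_eventuallyEq ?_).contMDiffWithinAt
    -- Near `y` the local inverses at `u` and at `L y` agree, as both invert `f` near `L y`.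
    have h2 : ContinuousAt L y := L.continuousAt hy
    have h3 : ∀ᶠ z in 𝓝 y, L z ∈ (hf.localInverseAt (L y)).target :=
      h2 ((hf.localInverseAt (L y)).open_target.mem_nhds hf.self_mem_localInverseAt_target)
    filter_upwards [h3, L.open_source.mem_nhds hy] with z hz hz'
    have h4 := (hf.localInverseAt (L y)).right_inv hz
    rw [hf.localInverseAt_symm, hf.apply_localInverseAt_of_mem hz'] at h4
    exact h4.symm
  · intro v _
    exact (congrFun (hf.localInverseAt_symm u) v).symm

end LocalDiffeo

/-! ### Automorphisms of the torus -/

section Torus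

theorem Torus.isLocalDiffeomorph_mk (n : ℕ) :
    IsLocalDiffeomorph 𝓘(ℝ, Fin n → ℝ) 𝓘(ℝ, Fin n → ℝ) ∞
      (Torus.mk : (Fin n → ℝ) → Torus n) := by
  refine isLocalDiffeomorph_chartedSpaceOfRightInverse
    (Torus.isQuotientCoveringMap_mk n).isCoveringMap.isLocalHomeomorph
    (Torus.isQuotientCoveringMap_mk n).surjective.hasRightInverse.choose_spec ?_
  intro u v huv
  refine ⟨fun w => w + (v - u), ?_, by simp, Filter.Eventually.of_forall fun w => ?_⟩
  · exact (contDiff_id.add contDiff_const).contMDiff.contMDiffAt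
  · refine QuotientAddGroup.eq.2 ?_
    have h1 := (intLattice n).neg_mem (QuotientAddGroup.eq.1 huv)
    have h2 : -(w + (v - u)) + w = -(-u + v) := by abel
    exact h2 ▸ h1

theorem contMDiff_torusEnd {n : ℕ} (A : Matrix (Fin n) (Fin n) ℤ) :
    ContMDiff 𝓘(ℝ, Fin n → ℝ) 𝓘(ℝ, Fin n → ℝ) ∞ (torusEnd A) := by
  intro a
  obtain ⟨t, rfl⟩ := (Torus.isQuotientCoveringMap_mk n).surjective a
  have hd := Torus.isLocalDiffeomorph_mk n
  have h1 : ContMDiff 𝓘(ℝ, Fin n → ℝ) 𝓘(ℝ, Fin n → ℝ) ∞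
      (fun s : Fin n → ℝ => A.map ((↑) : ℤ → ℝ) *ᵥ s) :=
    (LinearMap.toContinuousLinearMap
      (Matrix.mulVecLin (A.map ((↑) : ℤ → ℝ)))).contDiff.contMDiff
  have h2 := (hd.contMDiff.comp h1 _).comp (Torus.mk t) (hd t).localInverse_contMDiffAt
  refine h2.congr_of_eventuallyEq ?_
  filter_upwards [(hd t).localInverse_eventuallyEq_right] with b hb
  conv_lhs => rw [show b = Torus.mk ((hd t).localInverse b) from hb.symm]
  rfl

theorem isLieGroupIso_torusAut {n : ℕ} (A : GL (Fin n) ℤ) :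
    IsLieGroupIso (AddEquiv.toMultiplicative.symm (torusAut n A)) :=
  ⟨contMDiff_torusEnd _, contMDiff_torusEnd _⟩

/-- A continuous endomorphism of the torus lifts to a continuous map of the universal covering
`ℝⁿ`, which is additive because its failure to be so is continuous with values in `ℤⁿ`. -/
theorem exists_eq_torusEnd {n : ℕ} (ρ : Torus n →+ Torus n) (hρ : Continuous ρ) :
    ∃ A : Matrix (Fin n) (Fin n) ℤ, ρ = torusEnd A := by
  have hcov := (Torus.isQuotientCoveringMap_mk n).isCoveringMap
  have hmk : Continuous (Torus.mk : (Fin n → ℝ) → Torus n) := hcov.continuous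
  have hmem : ∀ s : Fin n → ℝ, (Torus.mk s = 0) ↔ s ∈ intLattice n := fun s =>
    QuotientAddGroup.eq_zero_iff s
  obtain ⟨F, ⟨hF0, hF⟩, -⟩ := hcov.existsUnique_continuousMap_lifts
    ⟨fun t : Fin n → ℝ => ρ (Torus.mk t), hρ.comp hmk⟩ 0 0
    (by change Torus.mk 0 = ρ (Torus.mk 0); rw [show (Torus.mk 0 : Torus n) = 0 from rfl, map_zero])
  have hF' : ∀ t, Torus.mk (F t) = ρ (Torus.mk t) := fun t => congrFun hF t
  have hadd : ∀ s t, F (s + t) = F s + F t := by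
    intro s t
    let d : (Fin n → ℝ) × (Fin n → ℝ) → Fin n → ℝ := fun z => F (z.1 + z.2) - F z.1 - F z.2
    have hd : Continuous d := by fun_prop
    have hdm : ∀ z, d z ∈ intLattice n := by
      intro z
      rw [← hmem]
      change Torus.mk (F (z.1 + z.2)) - Torus.mk (F z.1) - Torus.mk (F z.2) = 0
      rw [hF', hF', hF', show Torus.mk (z.1 + z.2) = Torus.mk z.1 + Torus.mk z.2 from rfl, map_add]
      abel
    have h1 : d (s, t) = d (0, 0) :=
      isPreconnected_univ.constant_of_mapsTo (isDiscrete_intLattice n) hd.continuousOn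
        (fun z _ => hdm z) (mem_univ _) (mem_univ _)
    have h2 : F (s + t) - F s - F t = F (0 + 0) - F 0 - F 0 := h1
    rw [add_zero, hF0, sub_sub, sub_eq_iff_eq_add] at h2
    simpa using h2
  let L : (Fin n → ℝ) →L[ℝ] (Fin n → ℝ) :=
    AddMonoidHom.toRealLinearMap ⟨⟨F, hF0⟩, hadd⟩ F.continuous
  have hL : ∀ t, Torus.mk (L t) = ρ (Torus.mk t) := hF'
  have hint : ∀ k : Fin n, ∃ l : Fin n → ℤ, L (Pi.single k 1) = fun i => (l i : ℝ) := by
    intro k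
    refine (hmem _).1 ?_
    rw [hL, (hmem _).2 ⟨Pi.single k 1, ?_⟩, map_zero]
    ext i
    by_cases hi : i = k
    · subst hi; simp
    · simp [hi]
  choose l hl using hint
  refine ⟨Matrix.of fun i k => l k i, ?_⟩
  refine AddMonoidHom.ext fun a => ?_
  obtain ⟨t, rfl⟩ := (Torus.isQuotientCoveringMap_mk n).surjective a
  rw [torusEnd_mk]
  rw [← hL]
  congr 1
  have h1 : L t = ∑ k, t k • L (Pi.single k 1) := by
    conv_lhs => rw [← Finset.univ_sum_single t]
    rw [map_sum]
    refine Finset.sum_congr rfl fun k _ => ?_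
    rw [← map_smul, ← Pi.single_smul, smul_eq_mul, mul_one]
  ext i
  rw [h1, Finset.sum_apply]
  simp [hl, Matrix.mulVec, dotProduct, mul_comm]

end Torus

/-! ### The coordinates of `TM` in a parallel frame -/

section Frame

variable {n : ℕ} {M : Type*} [TopologicalSpace M] [ChartedSpace (EuclideanSpace ℝ (Fin n)) M]
  [IsManifold (𝓡 n) ∞ M]

theorem trivializationAt_self_snd (p : M) (v : TangentSpace (𝓡 n) p) :
    (trivializationAt (EuclideanSpace ℝ (Fin n)) (TangentSpace (𝓡 n) : M → Type _) p
      (⟨p, v⟩ : TM n M)).2 = v :=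
  (tangentBundleCore (𝓡 n) M).coordChange_self (achart _ p) p (mem_achart_source _ p) v

namespace ParallelFrame

variable {cov : AffineConnection n M} (X : ParallelFrame cov)

/-- The linear map `t ↦ ∑ᵢ tᵢ Xᵢ(q)`, read in the trivialization of `TM` centred at `p`. -/
def frameMap (p q : M) : (Fin n → ℝ) →L[ℝ] EuclideanSpace ℝ (Fin n) :=
  ∑ i, (ContinuousLinearMap.proj i : (Fin n → ℝ) →L[ℝ] ℝ).smulRight
    (trivializationAt (EuclideanSpace ℝ (Fin n)) (TangentSpace (𝓡 n)) p
      (⟨q, X.X i q⟩ : TM n M)).2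

theorem contMDiffAt_frameMap (p : M) :
    ContMDiffAt (𝓡 n) 𝓘(ℝ, (Fin n → ℝ) →L[ℝ] EuclideanSpace ℝ (Fin n)) ∞ (X.frameMap p) p := by
  have h1 : ∀ i, ContMDiffAt (𝓡 n) 𝓘(ℝ, EuclideanSpace ℝ (Fin n)) ∞ (fun q =>
      (trivializationAt (EuclideanSpace ℝ (Fin n)) (TangentSpace (𝓡 n)) p
        (⟨q, X.X i q⟩ : TM n M)).2) p := fun i =>
    (Bundle.contMDiffAt_section p).1 (X.smooth i p)
  have h2 : ∀ i, ContMDiffAt (𝓡 n) 𝓘(ℝ, (Fin n → ℝ) →L[ℝ] EuclideanSpace ℝ (Fin n)) ∞ (fun q =>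
      (ContinuousLinearMap.proj i : (Fin n → ℝ) →L[ℝ] ℝ).smulRight
        (trivializationAt (EuclideanSpace ℝ (Fin n)) (TangentSpace (𝓡 n)) p
          (⟨q, X.X i q⟩ : TM n M)).2) p := fun i =>
    (ContinuousLinearMap.smulRightL ℝ (Fin n → ℝ) (EuclideanSpace ℝ (Fin n))
      (ContinuousLinearMap.proj i)).contDiff.contMDiff.contMDiffAt.comp p (h1 i)
  exact contMDiffAt_finsetSum fun i _ => h2 i

theorem frameMap_apply {p q : M} (hq : q ∈ (trivializationAt (EuclideanSpace ℝ (Fin n))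
    (TangentSpace (𝓡 n) : M → Type _) p).baseSet) (t : Fin n → ℝ) :
    X.frameMap p q t = (trivializationAt (EuclideanSpace ℝ (Fin n)) (TangentSpace (𝓡 n)) p
      (⟨q, ∑ i, t i • X.X i q⟩ : TM n M)).2 := by
  set e := trivializationAt (EuclideanSpace ℝ (Fin n)) (TangentSpace (𝓡 n) : M → Type _) p
  have hl : ∀ v, (e (⟨q, v⟩ : TM n M)).2 = e.continuousLinearEquivAt ℝ q hq v := fun v => rfl
  rw [hl, map_sum, frameMap, sum_apply]
  refine Finset.sum_congr rfl fun i _ => ?_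
  rw [map_smul]
  rfl

theorem frameMap_self (p : M) (t : Fin n → ℝ) :
    X.frameMap p p t = (∑ i, t i • X.X i p : TangentSpace (𝓡 n) p) := by
  rw [X.frameMap_apply (mem_baseSet_trivializationAt _ _ p)]
  exact trivializationAt_self_snd p _

theorem eventually_mem_baseSet (u : TM n M) : ∀ᶠ w : TM n M in 𝓝 u,
    w.1 ∈ (trivializationAt (EuclideanSpace ℝ (Fin n))
      (TangentSpace (𝓡 n) : M → Type _) u.1).baseSet :=
  (FiberBundle.continuous_proj _ _).continuousAt ((trivializationAt (EuclideanSpace ℝ (Fin n))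
    (TangentSpace (𝓡 n) : M → Type _) u.1).open_baseSet.mem_nhds
    (mem_baseSet_trivializationAt _ _ u.1))

theorem frameMap_coord {p : M} {w : TM n M} (hw : w.1 ∈ (trivializationAt
    (EuclideanSpace ℝ (Fin n)) (TangentSpace (𝓡 n) : M → Type _) p).baseSet) :
    X.frameMap p w.1 (X.coord w) =
      (trivializationAt (EuclideanSpace ℝ (Fin n)) (TangentSpace (𝓡 n)) p w).2 := by
  rw [X.frameMap_apply hw, X.sum_coord]

theorem isInvertible_frameMap {p q : M} (hq : q ∈ (trivializationAt (EuclideanSpace ℝ (Fin n))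
    (TangentSpace (𝓡 n) : M → Type _) p).baseSet) : (X.frameMap p q).IsInvertible := by
  set e := trivializationAt (EuclideanSpace ℝ (Fin n)) (TangentSpace (𝓡 n) : M → Type _) p
  have hinj : Function.Injective (X.frameMap p q) := by
    intro s t hst
    rw [X.frameMap_apply hq, X.frameMap_apply hq] at hst
    have h2 : (∑ i, s i • X.X i q : TangentSpace (𝓡 n) q) = ∑ i, t i • X.X i q :=
      (e.continuousLinearEquivAt ℝ q hq).injective hst
    rw [← X.eq_coord (u := (⟨q, ∑ i, s i • X.X i q⟩ : TM n M)) rfl,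
      ← X.eq_coord (u := (⟨q, ∑ i, t i • X.X i q⟩ : TM n M)) rfl, h2]
  exact ⟨(LinearEquiv.ofInjectiveOfFinrankEq (X.frameMap p q).toLinearMap hinj
    (by simp)).toContinuousLinearEquiv, rfl⟩

theorem contMDiff_proj : ContMDiff (𝓡 n).tangent (𝓡 n) ∞ (TotalSpace.proj : TM n M → M) :=
  Bundle.contMDiff_proj _

theorem contMDiff_coord : ContMDiff (𝓡 n).tangent 𝓘(ℝ, Fin n → ℝ) ∞ X.coord := by
  intro u
  have h1 : ContMDiffAt (𝓡 n).tangent 𝓘(ℝ, (Fin n → ℝ) →L[ℝ] EuclideanSpace ℝ (Fin n)) ∞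
      (fun w : TM n M => X.frameMap u.1 w.1) u :=
    (X.contMDiffAt_frameMap u.1).comp u (contMDiff_proj u)
  have h2 : ContMDiffAt (𝓡 n).tangent 𝓘(ℝ, EuclideanSpace ℝ (Fin n) →L[ℝ] (Fin n → ℝ)) ∞
      (fun w : TM n M => (X.frameMap u.1 w.1).inverse) u :=
    (X.isInvertible_frameMap
      (mem_baseSet_trivializationAt _ _ u.1)).contDiffAt_map_inverse.contMDiffAt.comp u h1
  have h3 : ContMDiffAt (𝓡 n).tangent 𝓘(ℝ, EuclideanSpace ℝ (Fin n)) ∞ (fun w : TM n M =>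
      (trivializationAt (EuclideanSpace ℝ (Fin n)) (TangentSpace (𝓡 n)) u.1 w).2) u :=
    ((Bundle.contMDiffAt_totalSpace (f := fun w : TM n M => w)).1 contMDiffAt_id).2
  refine (h2.clm_apply h3).congr_of_eventuallyEq ?_
  filter_upwards [eventually_mem_baseSet u] with w hw
  rw [← X.frameMap_coord hw, (X.isInvertible_frameMap hw).inverse_apply_self]

/-- Joint smoothness of the translations in the translation vector and the point. -/
theorem contMDiffAt_translate {E H N : Type*} [NormedAddCommGroup E] [NormedSpace ℝ E]
    [TopologicalSpace H] {I : ModelWithCorners ℝ E H} [TopologicalSpace N] [ChartedSpace H N]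
    {a : N → Fin n → ℝ} {f : N → TM n M} {x : N} (ha : ContMDiffAt I 𝓘(ℝ, Fin n → ℝ) ∞ a x)
    (hf : ContMDiffAt I (𝓡 n).tangent ∞ f x) :
    ContMDiffAt I (𝓡 n).tangent ∞ (fun y => X.translate (a y) (f y)) x := by
  obtain ⟨h1, h2⟩ := Bundle.contMDiffAt_totalSpace.1 hf
  refine Bundle.contMDiffAt_totalSpace.2 ⟨h1, ?_⟩
  have h3 := h2.add (((X.contMDiffAt_frameMap (f x).1).comp x h1).clm_apply ha)
  refine h3.congr_of_eventuallyEq ?_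
  filter_upwards [hf.continuousAt.eventually (eventually_mem_baseSet (f x))] with y hy
  set e := trivializationAt (EuclideanSpace ℝ (Fin n)) (TangentSpace (𝓡 n) : M → Type _) (f x).1
  have hl : ∀ v, (e (⟨(f y).1, v⟩ : TM n M)).2 = e.continuousLinearEquivAt ℝ (f y).1 hy v :=
    fun v => rfl
  change (e ⟨(f y).1, (f y).2 + ∑ i, a y i • X.X i (f y).1⟩).2 =
    (e ⟨(f y).1, (f y).2⟩).2 + X.frameMap (f x).1 (f y).1 (a y)
  rw [X.frameMap_apply hy, hl, hl, map_add]
  rfl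

theorem contMDiff_translate (t : Fin n → ℝ) :
    ContMDiff (𝓡 n).tangent (𝓡 n).tangent ∞ (X.translate t) := fun _ =>
  X.contMDiffAt_translate contMDiffAt_const contMDiffAt_id

/-! ### The connector of a connection with a parallel frame -/

/-- The derivative of the frame coordinates of `TM`. -/
def dcoord (u : TM n M) : TangentSpace (𝓡 n).tangent u →L[ℝ] (Fin n → ℝ) :=
  mfderiv (𝓡 n).tangent 𝓘(ℝ, Fin n → ℝ) X.coord u

/-- The section of `TM` whose coordinates in the frame are constant. -/
def constField (c : Fin n → ℝ) : VField n M := fun q => ∑ i, c i • X.X i q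

theorem coord_constField (c : Fin n → ℝ) (q : M) :
    X.coord (⟨q, X.constField c q⟩ : TM n M) = c :=
  X.eq_coord rfl

theorem constField_coord (u : TM n M) : X.constField (X.coord u) u.1 = u.2 := X.sum_coord u

theorem contMDiff_constField (c : Fin n → ℝ) :
    ContMDiff (𝓡 n) (𝓡 n).tangent ∞ (fun q => (⟨q, X.constField c q⟩ : TM n M)) := by
  have h0 : ContMDiff (𝓡 n) (𝓡 n).tangent ∞ (fun q => (⟨q, 0⟩ : TM n M)) :=
    Bundle.contMDiff_zeroSection ℝ _
  intro q
  refine (X.contMDiffAt_translate (a := fun _ => c) contMDiffAt_const (h0 q)).congr_of_eventuallyEq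
    (Filter.Eventually.of_forall fun q => ?_)
  change (⟨q, X.constField c q⟩ : TM n M) = ⟨q, 0 + X.constField c q⟩
  rw [zero_add]

theorem cov_constField (c : Fin n → ℝ) (p : M) : cov (X.constField c) p = 0 := by
  have hs : ∀ i, MDifferentiableAt (𝓡 n) (𝓡 n).tangent (fun q => (⟨q, X.X i q⟩ : TM n M)) p :=
    fun i => (X.smooth i).mdifferentiable (by simp) p
  have h1 : ∀ s : Finset (Fin n),
      MDifferentiableAt (𝓡 n) (𝓡 n).tangent
        (fun q => (⟨q, (∑ i ∈ s, c i • X.X i : VField n M) q⟩ : TM n M)) p ∧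
      cov (∑ i ∈ s, c i • X.X i : VField n M) p = 0 := by
    intro s
    induction s using Finset.induction_on with
    | empty =>
      refine ⟨?_, ?_⟩
      · exact (Bundle.contMDiff_zeroSection ℝ _ (n := ∞)).mdifferentiable (by simp) p
      · rw [Finset.sum_empty, CovariantDerivative.zero]
        rfl
    | insert i s hi ih =>
      have h2 : MDifferentiableAt (𝓡 n) (𝓡 n).tangent
          (fun q => (⟨q, (c i • X.X i : VField n M) q⟩ : TM n M)) p :=
        (hs i).smul_const_section
      rw [Finset.sum_insert hi]
      refine ⟨mdifferentiableAt_add_section h2 ih.1, ?_⟩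
      rw [cov.isCovariantDerivativeOnUniv.add h2 ih.1, ih.2,
        cov.isCovariantDerivativeOnUniv.smul_const (c i) (hs i), X.parallel, smul_zero, add_zero]
  have h3 : X.constField c = (∑ i, c i • X.X i : VField n M) := by
    funext q
    rw [Finset.sum_apply]
    rfl
  rw [h3]
  exact (h1 Finset.univ).2

/-- The derivative of a section with constant coordinates in the parallel frame: it is horizontal,
and the fibre coordinates do not change along it. -/
theorem connector_eq_zero_and_dcoord_eq_zero (c : Fin n → ℝ) (p : M) (v : TangentSpace (𝓡 n) p) :
    let A := mfderiv (𝓡 n) (𝓡 n).tangent (fun q => (⟨q, X.constField c q⟩ : TM n M)) p v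
    qPart ⟨p, X.constField c p⟩ A = v ∧ connector cov ⟨p, X.constField c p⟩ A = 0 ∧
      X.dcoord ⟨p, X.constField c p⟩ A = 0 := by
  have hs : MDifferentiableAt (𝓡 n) (𝓡 n).tangent
      (fun q => (⟨q, X.constField c q⟩ : TM n M)) p :=
    (X.contMDiff_constField c).mdifferentiable (by simp) p
  refine ⟨qPart_mfderiv _ _ hs v, ?_, ?_⟩
  · rw [connector_mfderiv cov _ p hs, X.cov_constField]
    rfl
  · have h1 := mfderiv_comp (I := 𝓡 n) (I' := (𝓡 n).tangent) (I'' := 𝓘(ℝ, Fin n → ℝ)) p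
      (g := X.coord) (f := fun q => (⟨q, X.constField c q⟩ : TM n M))
      (X.contMDiff_coord.mdifferentiable (by simp) _) hs
    have h2 : X.coord ∘ (fun q => (⟨q, X.constField c q⟩ : TM n M)) = fun _ => c :=
      funext fun q => X.coord_constField c q
    rw [h2, mfderiv_const] at h1
    exact (congrArg (fun L => L v) h1).symm

/-- Derivative of the identity `(w)₂ = ∑ᵢ coordᵢ(w) Xᵢ(π(w))`, read in the trivialization centred at
`π(u)`; the second term comes from the variation of the frame. -/
theorem rPart_eq (u : TM n M) : ∃ D : TangentSpace (𝓡 n) u.1 →L[ℝ] TangentSpace (𝓡 n) u.1,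
    ∀ A, rPart u A = (∑ i, X.dcoord u A i • X.X i u.1 : TangentSpace (𝓡 n) u.1) +
      D (qPart u A) := by
  let F' : EuclideanSpace ℝ (Fin n) →L[ℝ] ((Fin n → ℝ) →L[ℝ] EuclideanSpace ℝ (Fin n)) :=
    mfderiv (𝓡 n) 𝓘(ℝ, (Fin n → ℝ) →L[ℝ] EuclideanSpace ℝ (Fin n)) (X.frameMap u.1) u.1
  have h1 : HasMFDerivAt (𝓡 n).tangent 𝓘(ℝ, (Fin n → ℝ) →L[ℝ] EuclideanSpace ℝ (Fin n))
      (fun w : TM n M => X.frameMap u.1 w.1) u (F'.comp (projDeriv u)) :=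
    (((X.contMDiffAt_frameMap u.1).mdifferentiableAt (by simp)).hasMFDerivAt).comp u
      (mdifferentiableAt_proj _).hasMFDerivAt
  have h2 : HasMFDerivAt (𝓡 n).tangent 𝓘(ℝ, Fin n → ℝ) X.coord u (X.dcoord u) :=
    (X.contMDiff_coord.mdifferentiable (by simp) u).hasMFDerivAt
  have h3 := (isBoundedBilinearMap_apply (𝕜 := ℝ) (E := Fin n → ℝ)
    (F := EuclideanSpace ℝ (Fin n))).hasFDerivAt (X.frameMap u.1 u.1, X.coord u)
  have h12 : HasMFDerivAt (𝓡 n).tangent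
      𝓘(ℝ, ((Fin n → ℝ) →L[ℝ] EuclideanSpace ℝ (Fin n)) × (Fin n → ℝ))
      (fun w : TM n M => (X.frameMap u.1 w.1, X.coord w)) u
      ((F'.comp (projDeriv u)).prod (X.dcoord u)) := by
    rw [modelWithCornersSelf_prod, ← chartedSpaceSelf_prod]
    exact h1.prodMk h2
  have h4 := HasMFDerivAt.comp (f := fun w : TM n M => (X.frameMap u.1 w.1, X.coord w)) u
    h3.hasMFDerivAt h12
  have h5 := (hasMFDerivAt_rCoord u).congr_of_eventuallyEq (f₁ := fun w : TM n M =>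
    X.frameMap u.1 w.1 (X.coord w)) (by
      filter_upwards [eventually_mem_baseSet u] with w hw
      exact X.frameMap_coord hw)
  have h6 := hasMFDerivAt_unique h5 h4
  refine ⟨F'.flip (X.coord u), fun A => ?_⟩
  refine (congrArg (fun L => L A) h6).trans ?_
  change X.frameMap u.1 u.1 (X.dcoord u A) + F' (projDeriv u A) (X.coord u) = _
  rw [X.frameMap_self, projDeriv_eq]
  rfl

/-- In the frame coordinates the connector is the derivative of the fibre coordinates: both sides
agree on the vertical vectors, and both vanish on the derivatives of the parallel sections
`∑ᵢ cᵢ Xᵢ` with constant `c`. -/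
theorem connector_eq (u : TM n M) (A : TangentSpace (𝓡 n).tangent u) :
    connector cov u A = ∑ i, X.dcoord u A i • X.X i u.1 := by
  obtain ⟨p, c, rfl⟩ : ∃ p c, u = ⟨p, X.constField c p⟩ :=
    ⟨u.1, X.coord u, by rw [X.constField_coord u]⟩
  obtain ⟨D, hD⟩ := X.rPart_eq ⟨p, X.constField c p⟩
  obtain ⟨h1, h2, h3⟩ :=
    X.connector_eq_zero_and_dcoord_eq_zero c p (qPart ⟨p, X.constField c p⟩ A)
  set B := mfderiv (𝓡 n) (𝓡 n).tangent (fun q => (⟨q, X.constField c q⟩ : TM n M)) p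
    (qPart ⟨p, X.constField c p⟩ A)
  have h4 := hD B
  have h5 := hD A
  have h6 : connector cov ⟨p, X.constField c p⟩ A = rPart ⟨p, X.constField c p⟩ A +
    cov (extend (EuclideanSpace ℝ (Fin n)) (X.constField c p)) p
      (qPart ⟨p, X.constField c p⟩ A) := rfl
  have h7 : connector cov ⟨p, X.constField c p⟩ B = rPart ⟨p, X.constField c p⟩ B +
    cov (extend (EuclideanSpace ℝ (Fin n)) (X.constField c p)) p
      (qPart ⟨p, X.constField c p⟩ B) := rfl
  rw [h2, h1, h4, h1, h3] at h7
  rw [h6, h5, add_assoc]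
  have h8 : (∑ i, (0 : Fin n → ℝ) i • X.X i p : TangentSpace (𝓡 n) p) = 0 := by simp
  rw [h8, zero_add] at h7
  rw [← h7, add_zero]

theorem connector_eq_zero_iff (u : TM n M) (A : TangentSpace (𝓡 n).tangent u) :
    connector cov u A = 0 ↔ X.dcoord u A = 0 := by
  rw [X.connector_eq]
  constructor
  · intro h
    have h1 := Fintype.linearIndependent_iff.1 (X.linearIndependent u.1) _ h
    exact funext h1
  · intro h
    rw [h]
    simp

end ParallelFrame

theorem tangent_ext {cov : AffineConnection n M} {u : TM n M} {A B : TangentSpace (𝓡 n).tangent u}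
    (h1 : projDeriv u A = projDeriv u B) (h2 : connector cov u A = connector cov u B) : A = B :=
  (splitting cov u).injective (Prod.ext h1 h2)

theorem projDeriv_splitting_symm (cov : AffineConnection n M) (u : TM n M)
    (v w : TangentSpace (𝓡 n) u.1) : projDeriv u ((splitting cov u).symm (v, w)) = v :=
  congrArg Prod.fst ((splitting cov u).apply_symm_apply (v, w))

theorem connector_splitting_symm (cov : AffineConnection n M) (u : TM n M)
    (v w : TangentSpace (𝓡 n) u.1) : connector cov u ((splitting cov u).symm (v, w)) = w :=
  congrArg Prod.snd ((splitting cov u).apply_symm_apply (v, w))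

end Frame

/-! ### Maps between tangent spaces of `TM` that respect the splitting -/

section Split

variable {n : ℕ} {M : Type*} [TopologicalSpace M] [ChartedSpace (EuclideanSpace ℝ (Fin n)) M]
  [IsManifold (𝓡 n) ∞ M] {cov : AffineConnection n M}

theorem projDeriv_tangentJ (u : TM n M) (A : TangentSpace (𝓡 n).tangent u) :
    projDeriv u (tangentJ cov u A) = -connector cov u A :=
  projDeriv_splitting_symm cov u _ _

theorem connector_tangentJ (u : TM n M) (A : TangentSpace (𝓡 n).tangent u) :
    connector cov u (tangentJ cov u A) = projDeriv u A :=
  connector_splitting_symm cov u _ _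

/-- A linear map `T` of tangent spaces of `TM` acts as `D × D` in the splitting into horizontal and
vertical parts. -/
structure IsSplitMap (cov : AffineConnection n M) {u u' : TM n M}
    (T : TangentSpace (𝓡 n).tangent u →L[ℝ] TangentSpace (𝓡 n).tangent u')
    (D : TangentSpace (𝓡 n) u.1 →L[ℝ] TangentSpace (𝓡 n) u'.1) : Prop where
  proj : ∀ A, projDeriv u' (T A) = D (projDeriv u A)
  conn : ∀ A, connector cov u' (T A) = D (connector cov u A)

variable {u u' : TM n M} {T : TangentSpace (𝓡 n).tangent u →L[ℝ] TangentSpace (𝓡 n).tangent u'}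
  {D : TangentSpace (𝓡 n) u.1 →L[ℝ] TangentSpace (𝓡 n) u'.1}

theorem IsSplitMap.map_tangentJ (hT : IsSplitMap cov T D) (A : TangentSpace (𝓡 n).tangent u) :
    T (tangentJ cov u A) = tangentJ cov u' (T A) := by
  apply tangent_ext (cov := cov)
  · rw [hT.proj, projDeriv_tangentJ, projDeriv_tangentJ, hT.conn, map_neg]
  · rw [hT.conn, connector_tangentJ, connector_tangentJ, hT.proj]

theorem IsSplitMap.tangentMetric_map (hT : IsSplitMap cov T D) {h : Metric n M}
    (hD : ∀ v w, h.inner u'.1 (D v) (D w) = h.inner u.1 v w)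
    (A B : TangentSpace (𝓡 n).tangent u) :
    tangentMetric h cov u' (T A) (T B) = tangentMetric h cov u A B := by
  simp only [tangentMetric, hT.proj, hT.conn, hD]

end Split

/-! ### The quotient map `q_L` -/

section Quot

variable {n : ℕ} {M : Type*} [TopologicalSpace M] [ChartedSpace (EuclideanSpace ℝ (Fin n)) M]
  [IsManifold (𝓡 n) ∞ M]

namespace ParallelFrame

variable {cov : AffineConnection n M} (X : ParallelFrame cov)

theorem q_surjective : Function.Surjective X.q := Quotient.mk_surjective

theorem q_translate_int (k : Fin n → ℤ) (u : TM n M) :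
    X.q (X.translate (fun i => (k i : ℝ)) u) = X.q u :=
  X.q_eq_iff.2 ⟨k, rfl⟩

theorem isLocalDiffeomorph_q :
    IsLocalDiffeomorph (𝓡 n).tangent (𝓡 n).tangent ∞ X.q := by
  refine isLocalDiffeomorph_chartedSpaceOfRightInverse
    X.isQuotientCoveringMap_q.isCoveringMap.isLocalHomeomorph
    X.isQuotientCoveringMap_q.surjective.hasRightInverse.choose_spec fun u v huv => ?_
  obtain ⟨k, hk⟩ := X.q_eq_iff.1 huv.symm
  exact ⟨X.translate fun i => (k i : ℝ), X.contMDiff_translate _ u, hk.symm,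
    Filter.Eventually.of_forall fun w => X.q_translate_int k w⟩

theorem contMDiff_q : ContMDiff (𝓡 n).tangent (𝓡 n).tangent ∞ X.q :=
  X.isLocalDiffeomorph_q.contMDiff

theorem mdifferentiableAt_q (u : TM n M) :
    MDifferentiableAt (𝓡 n).tangent (𝓡 n).tangent X.q u :=
  X.contMDiff_q.mdifferentiable (by simp) u

theorem isInvertible_dq (u : TM n M) : (X.dq u).IsInvertible :=
  ⟨(X.isLocalDiffeomorph_q u).mfderivToContinuousLinearEquiv (by simp), rfl⟩

theorem dq_surjective (u : TM n M) : Function.Surjective (X.dq u) := by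
  obtain ⟨e, he⟩ := X.isInvertible_dq u
  rw [← he]
  exact e.surjective

theorem dq_injective (u : TM n M) : Function.Injective (X.dq u) := by
  obtain ⟨e, he⟩ := X.isInvertible_dq u
  rw [← he]
  exact e.injective

section Descend

variable {E H N : Type*} [NormedAddCommGroup E] [NormedSpace ℝ E]
    [TopologicalSpace H] {I : ModelWithCorners ℝ E H} [TopologicalSpace N] [ChartedSpace H N]

theorem contMDiffAt_of_comp_q {F : X.ML → N} {u : TM n M}
    (hF : ContMDiffAt (𝓡 n).tangent I ∞ (fun w => F (X.q w)) u) :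
    ContMDiffAt (𝓡 n).tangent I ∞ F (X.q u) := by
  have hd := X.isLocalDiffeomorph_q u
  have h0 : hd.localInverse (X.q u) = u := hd.localInverse_left_inv hd.localInverse_mem_target
  refine ContMDiffAt.congr_of_eventuallyEq (f := (fun w => F (X.q w)) ∘ hd.localInverse)
    (ContMDiffAt.comp _ (by rwa [h0]) hd.localInverse_contMDiffAt) ?_
  filter_upwards [hd.localInverse_eventuallyEq_right] with y hy
  exact congrArg F hy.symm

/-- Near any point, a smooth map into `M_L` lifts to a smooth map into `TM` with a prescribed value
over the image of that point. -/
theorem exists_local_lift {F : N → X.ML} (hF : ContMDiff I (𝓡 n).tangent ∞ F) {x : N}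
    {u : TM n M} (hu : X.q u = F x) :
    ∃ f : N → TM n M, f x = u ∧
      ∀ᶠ y in 𝓝 x, ContMDiffAt I (𝓡 n).tangent ∞ f y ∧ X.q (f y) = F y := by
  have hd := X.isLocalDiffeomorph_q u
  have h0 : hd.localInverse (X.q u) = u := hd.localInverse_left_inv hd.localInverse_mem_target
  refine ⟨hd.localInverse ∘ F, ?_, ?_⟩
  · rw [Function.comp_apply, ← hu, h0]
  · have h1 : ∀ᶠ y in 𝓝 x, F y ∈ hd.localInverse.source := by
      refine hF.continuous.continuousAt (hd.localInverse_open_source.mem_nhds ?_)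
      rw [← hu]
      exact hd.localInverse_mem_source
    filter_upwards [h1] with y hy
    exact ⟨ContMDiffAt.comp y (hd.localInverse_contMDiffOn.contMDiffAt
      (hd.localInverse_open_source.mem_nhds hy)) (hF y), hd.localInverse_right_inv hy⟩

end Descend

/-- Chain rule for a germ `F` of a map of `M_L` with a lift `f` to `TM`. -/
theorem mfderiv_dq {F : X.ML → X.ML} {f : TM n M → TM n M} {u : TM n M}
    (hF : ContMDiffAt (𝓡 n).tangent (𝓡 n).tangent ∞ F (X.q u))
    (hf : ContMDiffAt (𝓡 n).tangent (𝓡 n).tangent ∞ f u)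
    (h : ∀ᶠ w in 𝓝 u, X.q (f w) = F (X.q w)) (A : TangentSpace (𝓡 n).tangent u) :
    mfderiv (𝓡 n).tangent (𝓡 n).tangent F (X.q u) (X.dq u A) =
      X.dq (f u) (mfderiv (𝓡 n).tangent (𝓡 n).tangent f u A) := by
  have h1 := mfderiv_comp (I := (𝓡 n).tangent) (I' := (𝓡 n).tangent) (I'' := (𝓡 n).tangent) u
    (hF.mdifferentiableAt (by simp)) (X.mdifferentiableAt_q u)
  have h2 := mfderiv_comp (I := (𝓡 n).tangent) (I' := (𝓡 n).tangent) (I'' := (𝓡 n).tangent) u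
    (X.mdifferentiableAt_q (f u)) (hf.mdifferentiableAt (by simp))
  have h3 : X.q ∘ f =ᶠ[𝓝 u] F ∘ X.q := h
  have h4 := h3.mfderiv_eq (I := (𝓡 n).tangent) (I' := (𝓡 n).tangent)
  refine (congrArg (fun L => L A) h1).symm.trans (Eq.trans ?_ (congrArg (fun L => L A) h2))
  exact (congrArg (fun L => L A) h4).symm

theorem projDeriv_mfderiv {f : TM n M → TM n M} {ψ : M → M} {u : TM n M}
    (hf : ContMDiffAt (𝓡 n).tangent (𝓡 n).tangent ∞ f u)
    (hψ : MDifferentiableAt (𝓡 n) (𝓡 n) ψ u.1) (h : ∀ᶠ w in 𝓝 u, (f w).1 = ψ w.1)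
    (A : TangentSpace (𝓡 n).tangent u) :
    projDeriv (f u) (mfderiv (𝓡 n).tangent (𝓡 n).tangent f u A) =
      mfderiv (𝓡 n) (𝓡 n) ψ u.1 (projDeriv u A) := by
  have h1 := mfderiv_comp (I := (𝓡 n).tangent) (I' := (𝓡 n).tangent) (I'' := 𝓡 n) u
    (g := (TotalSpace.proj : TM n M → M)) (f := f)
    (mdifferentiableAt_proj _) (hf.mdifferentiableAt (by simp))
  have h2 := mfderiv_comp (I := (𝓡 n).tangent) (I' := 𝓡 n) (I'' := 𝓡 n) u
    (g := ψ) (f := (TotalSpace.proj : TM n M → M)) hψ (mdifferentiableAt_proj _)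
  have h3 : (TotalSpace.proj : TM n M → M) ∘ f =ᶠ[𝓝 u] ψ ∘ (TotalSpace.proj : TM n M → M) := h
  have h4 := h3.mfderiv_eq (I := (𝓡 n).tangent) (I' := 𝓡 n)
  refine (congrArg (fun L => L A) h1).symm.trans (Eq.trans ?_ (congrArg (fun L => L A) h2))
  exact congrArg (fun L => L A) h4

theorem dcoord_mfderiv {f : TM n M → TM n M} {L : (Fin n → ℝ) →L[ℝ] (Fin n → ℝ)} {c : Fin n → ℝ}
    {u : TM n M} (hf : ContMDiffAt (𝓡 n).tangent (𝓡 n).tangent ∞ f u)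
    (h : ∀ᶠ w in 𝓝 u, X.coord (f w) = L (X.coord w) + c) (A : TangentSpace (𝓡 n).tangent u) :
    X.dcoord (f u) (mfderiv (𝓡 n).tangent (𝓡 n).tangent f u A) = L (X.dcoord u A) := by
  have h1 := mfderiv_comp (I := (𝓡 n).tangent) (I' := (𝓡 n).tangent) (I'' := 𝓘(ℝ, Fin n → ℝ)) u
    (g := X.coord) (f := f) (X.contMDiff_coord.mdifferentiable (by simp) _)
    (hf.mdifferentiableAt (by simp))
  have h2 : HasMFDerivAt (𝓡 n).tangent 𝓘(ℝ, Fin n → ℝ) X.coord u (X.dcoord u) :=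
    (X.contMDiff_coord.mdifferentiable (by simp) u).hasMFDerivAt
  have h3 : HasFDerivAt (fun z => L z + c) L (X.coord u) := L.hasFDerivAt.add_const c
  have h4 := (h3.hasMFDerivAt.comp u h2).mfderiv
  have h5 : X.coord ∘ f =ᶠ[𝓝 u] (fun z => L z + c) ∘ X.coord := h
  have h6 := h5.mfderiv_eq (I := (𝓡 n).tangent) (I' := 𝓘(ℝ, Fin n → ℝ))
  refine (congrArg (fun L => L A) h1).symm.trans (Eq.trans ?_ (congrArg (fun L => L A) h4))
  exact congrArg (fun L => L A) h6

theorem isSplitMap_translate (t : Fin n → ℝ) (u : TM n M) :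
    IsSplitMap cov (u := u) (u' := X.translate t u)
      (mfderiv (𝓡 n).tangent (𝓡 n).tangent (X.translate t) u)
      (ContinuousLinearMap.id ℝ (TangentSpace (𝓡 n) u.1)) := by
  constructor
  · intro A
    have h1 := projDeriv_mfderiv (ψ := id) (X.contMDiff_translate t u) mdifferentiableAt_id
      (Filter.Eventually.of_forall fun w => rfl) A
    rw [mfderiv_id] at h1
    exact h1
  · intro A
    have h1 := X.dcoord_mfderiv (L := ContinuousLinearMap.id ℝ _) (X.contMDiff_translate t u)
      (Filter.Eventually.of_forall fun w => X.coord_translate t w) A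
    rw [X.connector_eq, h1]
    exact (X.connector_eq u A).symm

/-! ### The Kähler structure of `M_L` -/

/-- The tangent vectors at two points of a fibre of `q_L` with the same image under `dq` correspond
to each other under an integral translation. -/
theorem exists_isSplitMap_inverse_dq {u w : TM n M} (hw : X.q w = X.q u) :
    ∃ k : Fin n → ℤ, w = X.translate (fun i => (k i : ℝ)) u ∧
    ∀ A : TangentSpace (𝓡 n).tangent u, (X.dq w).inverse (X.dq u A) =
      mfderiv (𝓡 n).tangent (𝓡 n).tangent (X.translate (fun i => (k i : ℝ))) u A := by
  obtain ⟨k, rfl⟩ := X.q_eq_iff.1 hw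
  refine ⟨k, rfl, fun A => ?_⟩
  have h1 := X.mfderiv_dq (F := id) (f := X.translate (fun i => (k i : ℝ))) (u := u)
    contMDiffAt_id (X.contMDiff_translate _ u)
    (Filter.Eventually.of_forall fun w => X.q_translate_int k w) A
  rw [mfderiv_id] at h1
  refine (congrArg _ h1).trans ?_
  exact (X.isInvertible_dq _).inverse_apply_self _

theorem metric_dq (h : Metric n M) (u : TM n M) (A B : TangentSpace (𝓡 n).tangent u) :
    X.metric h (X.q u) (X.dq u A) (X.dq u B) = tangentMetric h cov u A B := by
  have key : ∀ w, X.q w = X.q u → tangentMetric h cov w ((X.dq w).inverse (X.dq u A))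
      ((X.dq w).inverse (X.dq u B)) = tangentMetric h cov u A B := by
    intro w hw
    obtain ⟨k, rfl, hk⟩ := X.exists_isSplitMap_inverse_dq hw
    rw [hk, hk]
    exact (X.isSplitMap_translate _ u).tangentMetric_map (fun v w => rfl) A B
  exact key _ (X.q_lift _)

theorem J_dq (u : TM n M) (A : TangentSpace (𝓡 n).tangent u) :
    X.J (X.q u) (X.dq u A) = X.dq u (tangentJ cov u A) := by
  have key : ∀ w, X.q w = X.q u → X.dq w (tangentJ cov w ((X.dq w).inverse (X.dq u A))) =
      X.dq u (tangentJ cov u A) := by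
    intro w hw
    obtain ⟨k, rfl, hk⟩ := X.exists_isSplitMap_inverse_dq hw
    have h1 := X.mfderiv_dq (F := id) (f := X.translate (fun i => (k i : ℝ))) (u := u)
      contMDiffAt_id (X.contMDiff_translate _ u)
      (Filter.Eventually.of_forall fun w => X.q_translate_int k w) (tangentJ cov u A)
    rw [mfderiv_id] at h1
    rw [hk, ← (X.isSplitMap_translate _ u).map_tangentJ]
    exact h1.symm
  exact key _ (X.q_lift _)

theorem isKahlerCovering (h : Metric n M) : X.IsKahlerCovering h where
  covering := X.isQuotientCoveringMap_q.isCoveringMap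
  localDiffeo := X.isLocalDiffeomorph_q
  isometric := X.metric_dq h
  holomorphic := X.J_dq

end ParallelFrame
end Quot

/-! ### The action of `𝕋ⁿ ⋊ Diff(M, h, L)` on `M_L` -/

section Action

variable {n : ℕ} {M : Type*} [TopologicalSpace M] [ChartedSpace (EuclideanSpace ℝ (Fin n)) M]
  [IsManifold (𝓡 n) ∞ M]

namespace ParallelFrame

variable {cov : AffineConnection n M} (X : ParallelFrame cov)

theorem torusAction_zero (x : X.ML) : X.torusAction 0 x = x := by
  obtain ⟨u, rfl⟩ := X.q_surjective x
  exact congrArg X.q (X.translate_zero u)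

theorem torusAction_add (a b : Torus n) (x : X.ML) :
    X.torusAction (a + b) x = X.torusAction a (X.torusAction b x) := by
  obtain ⟨u, rfl⟩ := X.q_surjective x
  obtain ⟨s, rfl⟩ := QuotientAddGroup.mk_surjective a
  obtain ⟨t, rfl⟩ := QuotientAddGroup.mk_surjective b
  exact congrArg X.q (X.translate_add s t u)

theorem torusAction_eq_self {a : Torus n} {x : X.ML} (h : X.torusAction a x = x) : a = 0 := by
  obtain ⟨u, rfl⟩ := X.q_surjective x
  obtain ⟨t, rfl⟩ := QuotientAddGroup.mk_surjective a
  obtain ⟨k, hk⟩ := X.q_eq_iff.1 h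
  have h1 := congrArg X.coord hk
  rw [X.coord_translate, X.coord_translate] at h1
  exact (QuotientAddGroup.eq_zero_iff t).2 ⟨k, add_left_cancel h1⟩

theorem proj_eq_of_q_eq {u v : TM n M} (huv : X.q u = X.q v) : u.1 = v.1 := by
  obtain ⟨k, rfl⟩ := X.q_eq_iff.1 huv
  rfl

theorem sum_mulVec (A : Matrix (Fin n) (Fin n) ℝ) (c : Fin n → ℝ) (p : M) :
    ∑ k, c k • (∑ i, A i k • X.X i p) = (∑ i, (A *ᵥ c) i • X.X i p : TangentSpace (𝓡 n) p) := by
  simp only [Finset.smul_sum, Matrix.mulVec, dotProduct]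
  rw [Finset.sum_comm]
  refine Finset.sum_congr rfl fun i _ => ?_
  rw [Finset.sum_smul]
  refine Finset.sum_congr rfl fun k _ => ?_
  rw [smul_smul, mul_comm]

variable [ConnectedSpace M] (h : Metric n M)

theorem mfderiv_sum_frame (ψ : X.diffhL h) (p : M) (c : Fin n → ℝ) :
    mfderiv (𝓡 n) (𝓡 n) (ψ : Equiv.Perm M) p (∑ k, c k • X.X k p) =
      ∑ i, ((X.rotation h ψ).map ((↑) : ℤ → ℝ) *ᵥ c) i • X.X i ((ψ : Equiv.Perm M) p) := by
  rw [map_sum, ← X.sum_mulVec]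
  refine Finset.sum_congr rfl fun k _ => ?_
  rw [map_smul, X.rotation_spec]
  rfl

theorem coord_tangentMap (ψ : X.diffhL h) (u : TM n M) :
    X.coord (tangentMap (𝓡 n) (𝓡 n) (ψ : Equiv.Perm M) u) =
      (X.rotation h ψ).map ((↑) : ℤ → ℝ) *ᵥ X.coord u := by
  apply X.eq_coord
  change mfderiv (𝓡 n) (𝓡 n) (ψ : Equiv.Perm M) u.1 u.2 = _
  rw [← X.sum_coord u, X.mfderiv_sum_frame]
  rfl

theorem tangentMap_translate (ψ : X.diffhL h) (t : Fin n → ℝ) (u : TM n M) :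
    tangentMap (𝓡 n) (𝓡 n) (ψ : Equiv.Perm M) (X.translate t u) =
      X.translate ((X.rotation h ψ).map ((↑) : ℤ → ℝ) *ᵥ t)
        (tangentMap (𝓡 n) (𝓡 n) (ψ : Equiv.Perm M) u) := by
  refine TotalSpace.ext rfl (heq_of_eq ?_)
  change mfderiv (𝓡 n) (𝓡 n) (ψ : Equiv.Perm M) u.1 (u.2 + ∑ i, t i • X.X i u.1) = _
  rw [map_add, X.mfderiv_sum_frame]
  rfl

/-- The map of `M_L` induced by the derivative of `ψ ∈ Diff(M, h, L)`. -/
def push (ψ : X.diffhL h) : X.ML → X.ML :=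
  Quotient.lift (fun u => X.q (tangentMap (𝓡 n) (𝓡 n) (ψ : Equiv.Perm M) u)) (by
    intro u v huv
    obtain ⟨k, rfl⟩ := X.q_eq_iff.1 (Quotient.sound huv)
    rw [X.tangentMap_translate, X.q_eq_iff]
    refine ⟨X.rotation h ψ *ᵥ k, ?_⟩
    congr 1
    ext i
    simp [Matrix.mulVec, dotProduct])

theorem push_torusAction (ψ : X.diffhL h) (a : Torus n) (x : X.ML) :
    X.push h ψ (X.torusAction a x) =
      X.torusAction (torusEnd (X.rotation h ψ) a) (X.push h ψ x) := by
  obtain ⟨u, rfl⟩ := X.q_surjective x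
  obtain ⟨t, rfl⟩ := QuotientAddGroup.mk_surjective a
  exact congrArg X.q (X.tangentMap_translate h ψ t u)

theorem push_one (x : X.ML) : X.push h 1 x = x := by
  obtain ⟨u, rfl⟩ := X.q_surjective x
  exact congrArg X.q (congrFun (tangentMap_id (I := 𝓡 n) (M := M)) u)

theorem push_mul (φ ψ : X.diffhL h) (x : X.ML) :
    X.push h (φ * ψ) x = X.push h φ (X.push h ψ x) := by
  obtain ⟨u, rfl⟩ := X.q_surjective x
  refine congrArg X.q (congrFun (tangentMap_comp (I := 𝓡 n) (I' := 𝓡 n) (I'' := 𝓡 n)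
    (g := (φ : Equiv.Perm M)) (f := (ψ : Equiv.Perm M)) ?_ ?_) u)
  · exact φ.2.1.1.1.mdifferentiable (by simp)
  · exact ψ.2.1.1.1.mdifferentiable (by simp)

/-- The action `([t], ψ) • q_L(u) = q_L(ψ_* u + ∑ᵢ tᵢ Xᵢ)` of `𝕋ⁿ ⋊ Diff(M, h, L)` on `M_L`. -/
@[reducible]
def mulAction : MulAction (X.semidirect h) X.ML where
  smul g x := X.torusAction g.left.toAdd (X.push h g.right x)
  one_smul x := by
    change X.torusAction 0 (X.push h 1 x) = x
    rw [X.push_one, X.torusAction_zero]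
  mul_smul g g' x := by
    change X.torusAction (g.left.toAdd + torusEnd (X.rotation h g.right) g'.left.toAdd)
        (X.push h (g.right * g'.right) x) =
      X.torusAction g.left.toAdd (X.push h g.right
        (X.torusAction g'.left.toAdd (X.push h g'.right x)))
    rw [X.push_mul, X.push_torusAction, X.torusAction_add]

/-- The permutation of `M_L` by which an element of `𝕋ⁿ ⋊ Diff(M, h, L)` acts. -/
def permHom : X.semidirect h →* Equiv.Perm X.ML :=
  @MulAction.toPermHom (X.semidirect h) X.ML _ (X.mulAction h)

theorem permHom_mk_q (t : Fin n → ℝ) (ψ : X.diffhL h) (u : TM n M) :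
    X.permHom h ⟨Multiplicative.ofAdd (Torus.mk t), ψ⟩ (X.q u) =
      X.q (X.translate t (tangentMap (𝓡 n) (𝓡 n) (ψ : Equiv.Perm M) u)) := rfl

theorem contMDiff_translate_tangentMap (t : Fin n → ℝ) (ψ : X.diffhL h) :
    ContMDiff (𝓡 n).tangent (𝓡 n).tangent ∞
      (fun u => X.translate t (tangentMap (𝓡 n) (𝓡 n) (ψ : Equiv.Perm M) u)) :=
  (X.contMDiff_translate t).comp (ψ.2.1.1.1.contMDiff_tangentMap (by simp))

theorem isSplitMap_translate_tangentMap (t : Fin n → ℝ) (ψ : X.diffhL h) (u : TM n M) :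
    IsSplitMap cov (u := u)
      (u' := X.translate t (tangentMap (𝓡 n) (𝓡 n) (ψ : Equiv.Perm M) u))
      (mfderiv (𝓡 n).tangent (𝓡 n).tangent
        (fun u => X.translate t (tangentMap (𝓡 n) (𝓡 n) (ψ : Equiv.Perm M) u)) u)
      (mfderiv (𝓡 n) (𝓡 n) (ψ : Equiv.Perm M) u.1) := by
  have hf := X.contMDiff_translate_tangentMap h t ψ u
  constructor
  · exact projDeriv_mfderiv hf (ψ.2.1.1.1.mdifferentiable (by simp) _)
      (Filter.Eventually.of_forall fun w => rfl)
  · intro A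
    have h1 := X.dcoord_mfderiv (c := t) (L := LinearMap.toContinuousLinearMap
      (Matrix.mulVecLin ((X.rotation h ψ).map ((↑) : ℤ → ℝ)))) hf
      (Filter.Eventually.of_forall fun w => by
        rw [X.coord_translate, X.coord_tangentMap]
        rfl) A
    rw [X.connector_eq, h1, X.connector_eq u A]
    exact (X.mfderiv_sum_frame h ψ u.1 (X.dcoord u A)).symm

theorem contMDiff_permHom (g : X.semidirect h) :
    ContMDiff (𝓡 n).tangent (𝓡 n).tangent ∞ (X.permHom h g) := by
  intro x
  obtain ⟨u, rfl⟩ := X.q_surjective x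
  obtain ⟨t, ht⟩ := QuotientAddGroup.mk_surjective g.left.toAdd
  obtain ⟨a, ψ⟩ := g
  obtain rfl : a = Multiplicative.ofAdd (Torus.mk t) := ht.symm
  exact X.contMDiffAt_of_comp_q
    ((X.contMDiff_q.comp (X.contMDiff_translate_tangentMap h t ψ)) u)

theorem permHom_mem_autML (g : X.semidirect h) : X.permHom h g ∈ X.autML h := by
  have hs : (X.permHom h g).symm = X.permHom h g⁻¹ := (map_inv (X.permHom h) g).symm
  have hsm := X.contMDiff_permHom h g
  refine ⟨hsm, ?_, ?_⟩
  · rw [hs]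
    exact X.contMDiff_permHom h g⁻¹
  obtain ⟨t, ht⟩ := QuotientAddGroup.mk_surjective g.left.toAdd
  obtain ⟨a, ψ⟩ := g
  obtain rfl : a = Multiplicative.ofAdd (Torus.mk t) := ht.symm
  have hd := fun u => X.mfderiv_dq (u := u) (hsm (X.q u))
    (X.contMDiff_translate_tangentMap h t ψ u) (Filter.Eventually.of_forall fun w => rfl)
  refine ⟨?_, ?_, AddEquiv.toMultiplicative.symm (torusAut n (X.rotationHom h ψ)),
    isLieGroupIso_torusAut _, ?_⟩
  · intro x v w
    obtain ⟨u, rfl⟩ := X.q_surjective x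
    obtain ⟨A, rfl⟩ := X.dq_surjective u v
    obtain ⟨B, rfl⟩ := X.dq_surjective u w
    rw [hd, hd, X.metric_dq]
    refine (X.metric_dq h _ _ _).trans ?_
    exact (X.isSplitMap_translate_tangentMap h t ψ u).tangentMetric_map (ψ.2.2.2 u.1) A B
  · intro x v
    obtain ⟨u, rfl⟩ := X.q_surjective x
    obtain ⟨A, rfl⟩ := X.dq_surjective u v
    rw [X.J_dq, hd, hd, (X.isSplitMap_translate_tangentMap h t ψ u).map_tangentJ]
    exact (X.J_dq _ _).symm
  · intro b x
    change X.torusAction (Torus.mk t) (X.push h ψ (X.torusAction b x)) =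
      X.torusAction (torusEnd (X.rotation h ψ) b) (X.torusAction (Torus.mk t) (X.push h ψ x))
    rw [X.push_torusAction, ← X.torusAction_add, ← X.torusAction_add, add_comm]

/-- The homomorphism `Γ : 𝕋ⁿ ⋊ Diff(M, h, L) → Aut(M_L, g)^{𝕋ⁿ}`. -/
def autHom : X.semidirect h →* X.autML h :=
  (X.permHom h).codRestrict (X.autML h) (X.permHom_mem_autML h)

theorem autHom_injective : Function.Injective (X.autHom h) := by
  rw [injective_iff_map_eq_one]
  rintro ⟨a, ψ⟩ hg
  have h1 : ∀ x, X.torusAction a.toAdd (X.push h ψ x) = x := fun x =>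
    congrArg (fun φ : X.autML h => (φ : Equiv.Perm X.ML) x) hg
  have h2 : ψ = 1 := by
    apply Subtype.ext
    ext p
    obtain ⟨t, ht⟩ := QuotientAddGroup.mk_surjective a.toAdd
    have h3 := h1 (X.q ⟨p, 0⟩)
    rw [← ht] at h3
    exact X.proj_eq_of_q_eq h3
  subst h2
  obtain ⟨p⟩ : Nonempty M := inferInstance
  -- The torus acts freely.
  have h4 : a.toAdd = 0 := X.torusAction_eq_self (x := X.q ⟨p, 0⟩) (by
    conv_rhs => rw [← h1 (X.q ⟨p, 0⟩)]
    rw [X.push_one])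
  exact SemidirectProduct.ext h4 rfl

end ParallelFrame
end Action

/-! ### Functions with vanishing derivative -/

section Const

variable {E N F : Type*} [NormedAddCommGroup E] [NormedSpace ℝ E]
  [TopologicalSpace N] [ChartedSpace E N] [IsManifold 𝓘(ℝ, E) 1 N]
  [NormedAddCommGroup F] [NormedSpace ℝ F]

theorem eventually_eq_of_mfderiv_eq_zero {g : N → F} {p : N}
    (hg : ∀ᶠ y in 𝓝 p, HasMFDerivAt 𝓘(ℝ, E) 𝓘(ℝ, F) g y 0) : ∀ᶠ y in 𝓝 p, g y = g p := by
  let x := extChartAt 𝓘(ℝ, E) p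
  have hcont : ContinuousAt x.symm (x p) := continuousAt_extChartAt_symm p
  have hxp : x.symm (x p) = p := extChartAt_to_inv p
  have h1 : ∀ᶠ z in 𝓝 (x p), z ∈ x.target ∧
      HasMFDerivAt 𝓘(ℝ, E) 𝓘(ℝ, F) g (x.symm z) 0 := by
    refine Filter.Eventually.and (extChartAt_target_mem_nhds p)
      (hcont.eventually (p := fun y => HasMFDerivAt 𝓘(ℝ, E) 𝓘(ℝ, F) g y 0) ?_)
    rwa [hxp]
  obtain ⟨ε, hε, hball⟩ := Metric.eventually_nhds_iff_ball.1 h1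
  have h2 : ∀ z ∈ Metric.ball (x p) ε, HasFDerivAt (g ∘ x.symm) (0 : E →L[ℝ] F) z := by
    intro z hz
    have h3 : MDifferentiableAt 𝓘(ℝ, E) 𝓘(ℝ, E) x.symm z := by
      refine ((contMDiffOn_extChartAt_symm (n := 1) p).contMDiffAt ?_).mdifferentiableAt (by simp)
      exact (isOpen_extChartAt_target p).mem_nhds (hball z hz).1
    have h4 := (hball z hz).2.comp z h3.hasMFDerivAt
    rw [ContinuousLinearMap.zero_comp] at h4
    exact h4.hasFDerivAt
  have h5 : ∀ z ∈ Metric.ball (x p) ε, g (x.symm z) = g p := by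
    intro z hz
    have h6 := Metric.isOpen_ball.is_const_of_fderiv_eq_zero (𝕜 := ℝ)
      (convex_ball (x p) ε).isPreconnected
      (fun z hz => (h2 z hz).differentiableAt.differentiableWithinAt)
      (fun z hz => (h2 z hz).fderiv) hz (Metric.mem_ball_self hε)
    rw [Function.comp_apply, Function.comp_apply, hxp] at h6
    exact h6
  have h7 : ∀ᶠ y in 𝓝 p, x y ∈ Metric.ball (x p) ε :=
    (continuousAt_extChartAt p) (Metric.ball_mem_nhds _ hε)
  filter_upwards [h7, extChartAt_source_mem_nhds (I := 𝓘(ℝ, E)) p] with y hy hy'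
  rw [← h5 _ hy]
  exact congrArg g (x.left_inv hy').symm

end Const

/-! ### Equivariant automorphisms of `M_L` -/

section Surj

variable {n : ℕ} {M : Type*} [TopologicalSpace M] [ChartedSpace (EuclideanSpace ℝ (Fin n)) M]
  [IsManifold (𝓡 n) ∞ M]

namespace ParallelFrame

variable {cov : AffineConnection n M} (X : ParallelFrame cov)

theorem constField_zero (p : M) : X.constField 0 p = 0 := by
  simp [constField]

theorem translate_coord (u : TM n M) :
    X.translate (X.coord u) ⟨u.1, X.constField 0 u.1⟩ = u := by
  refine TotalSpace.ext rfl (heq_of_eq ?_)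
  change X.constField 0 u.1 + ∑ i, X.coord u i • X.X i u.1 = u.2
  rw [X.constField_zero, X.sum_coord, zero_add]

/-- The projection `M_L → M`. -/
def baseProj : X.ML → M :=
  Quotient.lift (fun u : TM n M => u.1) fun _ _ huv => X.proj_eq_of_q_eq (Quotient.sound huv)

@[simp]
theorem baseProj_q (u : TM n M) : X.baseProj (X.q u) = u.1 := rfl

/-- The fibre coordinate `M_L → 𝕋ⁿ`, `q_L(u) ↦ [coord u]`. -/
def torusCoord : X.ML → Torus n :=
  Quotient.lift (fun u : TM n M => Torus.mk (X.coord u)) fun u v huv => by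
    obtain ⟨k, rfl⟩ := X.q_eq_iff.1 (Quotient.sound huv)
    refine QuotientAddGroup.eq.2 ⟨-k, ?_⟩
    rw [X.coord_translate]
    ext i
    simp

/-- The section of `M_L → M` induced by the zero section of `TM`. -/
def zeroSec (p : M) : X.ML := X.q ⟨p, X.constField 0 p⟩

theorem torusAction_torusCoord (x : X.ML) :
    X.torusAction (X.torusCoord x) (X.zeroSec (X.baseProj x)) = x := by
  obtain ⟨u, rfl⟩ := X.q_surjective x
  exact congrArg X.q (X.translate_coord u)

theorem baseProj_torusAction (a : Torus n) (x : X.ML) :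
    X.baseProj (X.torusAction a x) = X.baseProj x := by
  obtain ⟨u, rfl⟩ := X.q_surjective x
  obtain ⟨t, rfl⟩ := QuotientAddGroup.mk_surjective a
  rfl

theorem contMDiff_baseProj : ContMDiff (𝓡 n).tangent (𝓡 n) ∞ X.baseProj := by
  intro x
  obtain ⟨u, rfl⟩ := X.q_surjective x
  exact X.contMDiffAt_of_comp_q (contMDiff_proj u)

theorem contMDiff_zeroSec : ContMDiff (𝓡 n) (𝓡 n).tangent ∞ X.zeroSec :=
  X.contMDiff_q.comp (X.contMDiff_constField 0)

theorem J_dq_of_eq {u : TM n M} {x : X.ML} (hx : X.q u = x) (A : TangentSpace (𝓡 n).tangent u) :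
    X.J x (X.dq u A) = X.dq u (tangentJ cov u A) := by
  subst hx
  exact X.J_dq u A

theorem metric_dq_of_eq (h : Metric n M) {u : TM n M} {x : X.ML} (hx : X.q u = x)
    (A B : TangentSpace (𝓡 n).tangent u) :
    X.metric h x (X.dq u A) (X.dq u B) = tangentMetric h cov u A B := by
  subst hx
  exact X.metric_dq h u A B

/-- The derivative of a map into one fibre of `TM` which is affine in the fibre coordinates. -/
theorem projDeriv_dcoord_curve {g : (Fin n → ℝ) → TM n M}
    (hg : MDifferentiableAt 𝓘(ℝ, Fin n → ℝ) (𝓡 n).tangent g 0)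
    (hp : ∀ᶠ s in 𝓝 0, (g s).1 = (g 0).1) {L : (Fin n → ℝ) →L[ℝ] (Fin n → ℝ)} {c : Fin n → ℝ}
    (hL : ∀ᶠ s in 𝓝 0, X.coord (g s) = L s + c) (s : Fin n → ℝ) :
    projDeriv (g 0) (mfderiv 𝓘(ℝ, Fin n → ℝ) (𝓡 n).tangent g 0 s) = 0 ∧
      X.dcoord (g 0) (mfderiv 𝓘(ℝ, Fin n → ℝ) (𝓡 n).tangent g 0 s) = L s := by
  constructor
  · have h1 := mfderiv_comp (I := 𝓘(ℝ, Fin n → ℝ)) (I' := (𝓡 n).tangent) (I'' := 𝓡 n) 0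
      (g := (TotalSpace.proj : TM n M → M)) (f := g) (mdifferentiableAt_proj _) hg
    have h2 : (TotalSpace.proj : TM n M → M) ∘ g =ᶠ[𝓝 0] fun _ => (g 0).1 := hp
    have h3 := h2.mfderiv_eq (I := 𝓘(ℝ, Fin n → ℝ)) (I' := 𝓡 n)
    rw [mfderiv_const] at h3
    exact (congrArg (fun L => L s) h1).symm.trans (congrArg (fun L => L s) h3)
  · have h1 := mfderiv_comp (I := 𝓘(ℝ, Fin n → ℝ)) (I' := (𝓡 n).tangent)
      (I'' := 𝓘(ℝ, Fin n → ℝ)) 0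
      (g := X.coord) (f := g) (X.contMDiff_coord.mdifferentiable (by simp) _) hg
    have h2 : X.coord ∘ g =ᶠ[𝓝 0] fun s => L s + c := hL
    have h3 := h2.mfderiv_eq (I := 𝓘(ℝ, Fin n → ℝ)) (I' := 𝓘(ℝ, Fin n → ℝ))
    have h4 : HasFDerivAt (fun z => L z + c) L 0 := L.hasFDerivAt.add_const c
    rw [h4.hasMFDerivAt.mfderiv] at h3
    exact (congrArg (fun L => L s) h1).symm.trans (congrArg (fun L => L s) h3)

theorem eventually_eq_zero_of_mem_intLattice {N : Type*} [TopologicalSpace N]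
    {d : N → Fin n → ℝ} {x : N} (hd : ContinuousAt d x) (h0 : d x = 0)
    (hm : ∀ᶠ y in 𝓝 x, d y ∈ intLattice n) : ∀ᶠ y in 𝓝 x, d y = 0 := by
  have h1 : ∀ᶠ y in 𝓝 x, d y ∈ Metric.ball (0 : Fin n → ℝ) 1 := by
    apply hd
    rw [h0]
    exact Metric.ball_mem_nhds _ one_pos
  filter_upwards [h1, hm] with y hy hy'
  obtain ⟨k, hk⟩ := hy'
  rw [mem_ball_zero_iff] at hy
  ext i
  have h2 := (norm_le_pi_norm (d y) i).trans_lt hy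
  simp only [hk, Real.norm_eq_abs] at h2
  have h3 : |k i| < 1 := by exact_mod_cast h2
  rw [Int.abs_lt_one_iff] at h3
  rw [hk]
  simp [h3]

/-- Uniqueness of continuous germs of lifts along the covering `q_L`. -/
theorem eventually_eq_of_q_eq {N : Type*} [TopologicalSpace N] {f g : N → TM n M} {x : N}
    (hf : ContinuousAt f x) (hg : ContinuousAt g x) (hx : f x = g x)
    (hq : ∀ᶠ y in 𝓝 x, X.q (f y) = X.q (g y)) : ∀ᶠ y in 𝓝 x, f y = g y := by
  have hc : ∀ {f : N → TM n M}, ContinuousAt f x → ContinuousAt (fun y => X.coord (f y)) x :=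
    fun hf => X.continuous_coord.continuousAt.comp hf
  have h1 := eventually_eq_zero_of_mem_intLattice
    (d := fun y => X.coord (f y) - X.coord (g y)) ((hc hf).sub (hc hg)) (by simp [hx]) (by
      filter_upwards [hq] with y hy
      obtain ⟨k, hk⟩ := X.q_eq_iff.1 hy
      rw [hk, X.coord_translate, add_sub_cancel_left]
      exact ⟨k, rfl⟩)
  filter_upwards [h1, hq] with y hy hy'
  rw [← X.translate_coord (f y), ← X.translate_coord (g y), sub_eq_zero.1 hy,
    X.proj_eq_of_q_eq hy']

variable {φ : X.ML → X.ML} {A : Matrix (Fin n) (Fin n) ℤ}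

/-- The lifts of an equivariant map commute with small translations up to the matrix `A`. Hence
their derivatives act on vertical vectors by `A`. -/
theorem mfderiv_lift_vertical
    (hA : ∀ a x, φ (X.torusAction a x) = X.torusAction (torusEnd A a) (φ x))
    {f : TM n M → TM n M} {u : TM n M} (hf : ContMDiffAt (𝓡 n).tangent (𝓡 n).tangent ∞ f u)
    (hlift : ∀ᶠ w in 𝓝 u, X.q (f w) = φ (X.q w)) {V : TangentSpace (𝓡 n).tangent u}
    (hV : projDeriv u V = 0) :
    projDeriv (f u) (mfderiv (𝓡 n).tangent (𝓡 n).tangent f u V) = 0 ∧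
      X.dcoord (f u) (mfderiv (𝓡 n).tangent (𝓡 n).tangent f u V) =
        A.map ((↑) : ℤ → ℝ) *ᵥ X.dcoord u V := by
  -- The orbit map of the translations; every vertical vector at `u` is a derivative of it.
  obtain ⟨γ, rfl, hγ, hγt⟩ : ∃ γ : (Fin n → ℝ) → TM n M, γ 0 = u ∧
      ContMDiff 𝓘(ℝ, Fin n → ℝ) (𝓡 n).tangent ∞ γ ∧ ∀ s, γ s = X.translate s (γ 0) := by
    refine ⟨fun s => X.translate s u, X.translate_zero u, fun s => ?_, fun s => ?_⟩
    · exact X.contMDiffAt_translate contMDiffAt_id contMDiffAt_const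
    · simp only [X.translate_zero]
  have hγd := hγ.mdifferentiable (by simp) 0
  have hfd := hf.mdifferentiableAt (by simp)
  let L : (Fin n → ℝ) →L[ℝ] (Fin n → ℝ) :=
    LinearMap.toContinuousLinearMap (Matrix.mulVecLin (A.map ((↑) : ℤ → ℝ)))
  have hL : ∀ s, L s = A.map ((↑) : ℤ → ℝ) *ᵥ s := fun s => rfl
  have h1 := X.projDeriv_dcoord_curve hγd
    (Filter.Eventually.of_forall fun s => by rw [hγt s]; rfl)
    (L := ContinuousLinearMap.id ℝ _) (c := X.coord (γ 0))
    (Filter.Eventually.of_forall fun s => by rw [hγt s, X.coord_translate, add_comm]; rfl)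
  have h2 : V = mfderiv 𝓘(ℝ, Fin n → ℝ) (𝓡 n).tangent γ 0 (X.dcoord (γ 0) V) := by
    apply tangent_ext (cov := cov)
    · rw [hV, (h1 _).1]
    · rw [X.connector_eq, X.connector_eq, (h1 _).2]
      rfl
  -- By equivariance both sides have the same image in `M_L`, and they agree at `s = 0`.
  have h3 : ∀ᶠ s in 𝓝 0, f (γ s) = X.translate (L s) (f (γ 0)) := by
    refine X.eventually_eq_of_q_eq ?_ ?_ ?_ ?_
    · exact ContinuousAt.comp hf.continuousAt hγ.continuous.continuousAt
    · exact (X.contMDiffAt_translate (I := 𝓘(ℝ, Fin n → ℝ)) (a := L) (x := 0)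
        L.contDiff.contMDiff.contMDiffAt contMDiffAt_const).continuousAt
    · rw [map_zero, X.translate_zero]
    · filter_upwards [hγ.continuous.continuousAt.eventually hlift] with s hs
      rw [hs, hγt s, ← X.torusAction_mk, hA, ← hlift.self_of_nhds]
      rfl
  have h4 := X.projDeriv_dcoord_curve (g := f ∘ γ) (hfd.comp 0 hγd)
    (by
      filter_upwards [h3] with s hs
      rw [Function.comp_apply, hs]
      rfl)
    (L := L) (c := X.coord (f (γ 0)))
    (by
      filter_upwards [h3] with s hs
      rw [Function.comp_apply, hs, X.coord_translate, add_comm]) (X.dcoord (γ 0) V)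
  have h5 : mfderiv 𝓘(ℝ, Fin n → ℝ) (𝓡 n).tangent (f ∘ γ) 0 (X.dcoord (γ 0) V) =
      mfderiv (𝓡 n).tangent (𝓡 n).tangent f (γ 0) V := by
    refine (congrArg (fun L => L (X.dcoord (γ 0) V)) (mfderiv_comp 0 hfd hγd)).trans ?_
    exact (congrArg _ h2).symm
  rw [h5] at h4
  exact h4

/-- `φ` is a smooth holomorphic map of `M_L` which is equivariant along the endomorphism
`[t] ↦ [A t]` of the torus. -/
structure IsHolomorphicEquivariant (φ : X.ML → X.ML) (A : Matrix (Fin n) (Fin n) ℤ) : Prop where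
  smooth : ContMDiff (𝓡 n).tangent (𝓡 n).tangent ∞ φ
  holomorphic : ∀ x (v : TangentSpace (𝓡 n).tangent x),
    mfderiv (𝓡 n).tangent (𝓡 n).tangent φ x (X.J x v) =
      X.J (φ x) (mfderiv (𝓡 n).tangent (𝓡 n).tangent φ x v)
  equivariant : ∀ a x, φ (X.torusAction a x) = X.torusAction (torusEnd A a) (φ x)

variable {X}

/-- `J` exchanges vertical and horizontal vectors, so a holomorphic equivariant map acts on the
horizontal vectors by the same matrix as on the vertical ones. -/
theorem IsHolomorphicEquivariant.mfderiv_lift_horizontal (hφ : X.IsHolomorphicEquivariant φ A)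
    {f : TM n M → TM n M} {u : TM n M} (hf : ContMDiffAt (𝓡 n).tangent (𝓡 n).tangent ∞ f u)
    (hlift : ∀ᶠ w in 𝓝 u, X.q (f w) = φ (X.q w)) {H : TangentSpace (𝓡 n).tangent u}
    (hH : connector cov u H = 0) {c : Fin n → ℝ} (hc : projDeriv u H = ∑ k, c k • X.X k u.1) :
    connector cov (f u) (mfderiv (𝓡 n).tangent (𝓡 n).tangent f u H) = 0 ∧
      projDeriv (f u) (mfderiv (𝓡 n).tangent (𝓡 n).tangent f u H) =
        ∑ i, (A.map ((↑) : ℤ → ℝ) *ᵥ c) i • X.X i (f u).1 := by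
  set T := mfderiv (𝓡 n).tangent (𝓡 n).tangent f u with hT
  have hTJ : ∀ B, T (tangentJ cov u B) = tangentJ cov (f u) (T B) := by
    intro B
    apply X.dq_injective
    have h1 := X.mfderiv_dq (hφ.smooth _) hf hlift
    rw [← hT] at h1
    rw [← h1, ← X.J_dq, hφ.holomorphic, h1]
    exact X.J_dq_of_eq hlift.self_of_nhds _
  -- `J H` is vertical, and `H = -J (J H)`.
  have hV : projDeriv u (tangentJ cov u H) = 0 := by
    rw [projDeriv_tangentJ, hH, neg_zero]
  have hJV : tangentJ cov u (tangentJ cov u H) = -H := by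
    apply tangent_ext (cov := cov)
    · rw [projDeriv_tangentJ, connector_tangentJ, map_neg]
    · rw [connector_tangentJ, hV, map_neg, hH, neg_zero]
  have hdc : X.dcoord u (tangentJ cov u H) = c := by
    have h1 : (∑ k, X.dcoord u (tangentJ cov u H) k • X.X k u.1 : TangentSpace (𝓡 n) u.1) =
        ∑ k, c k • X.X k u.1 := by
      rw [← X.connector_eq, connector_tangentJ, hc]
    have h2 := X.coord_constField (X.dcoord u (tangentJ cov u H)) u.1
    rw [← h2, ← X.coord_constField c u.1]
    exact congrArg (fun v => X.coord (⟨u.1, v⟩ : TM n M)) h1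
  obtain ⟨h1, h2⟩ := X.mfderiv_lift_vertical hφ.equivariant hf hlift hV
  rw [← hT] at h1 h2
  have h3 : T H = -tangentJ cov (f u) (T (tangentJ cov u H)) := by
    rw [← hTJ, hJV, map_neg, neg_neg]
  constructor
  · rw [h3, map_neg, connector_tangentJ, h1, neg_zero]
  · rw [h3, map_neg, projDeriv_tangentJ, neg_neg, X.connector_eq, h2, hdc]

end ParallelFrame
end Surj

/-! ### The induced isometry of `M` -/

section Base

variable {n : ℕ} {M : Type*} [TopologicalSpace M] [ChartedSpace (EuclideanSpace ℝ (Fin n)) M]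
  [IsManifold (𝓡 n) ∞ M]

namespace ParallelFrame

variable {cov : AffineConnection n M} (X : ParallelFrame cov)

/-- The map of `M` induced by a map of `M_L` that permutes the torus orbits. -/
def baseMap (φ : X.ML → X.ML) (p : M) : M := X.baseProj (φ (X.zeroSec p))

section

variable {φ : X.ML → X.ML} {A : Matrix (Fin n) (Fin n) ℤ}

theorem contMDiff_baseMap (hφ : ContMDiff (𝓡 n).tangent (𝓡 n).tangent ∞ φ) :
    ContMDiff (𝓡 n) (𝓡 n) ∞ (X.baseMap φ) :=
  X.contMDiff_baseProj.comp (hφ.comp X.contMDiff_zeroSec)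

theorem exists_lift_zeroSec (hφ : ContMDiff (𝓡 n).tangent (𝓡 n).tangent ∞ φ) (p : M) :
    ∃ f : TM n M → TM n M, ∀ᶠ w in 𝓝 (⟨p, X.constField 0 p⟩ : TM n M),
      ContMDiffAt (𝓡 n).tangent (𝓡 n).tangent ∞ f w ∧ X.q (f w) = φ (X.q w) := by
  obtain ⟨u, hu⟩ := X.q_surjective (φ (X.zeroSec p))
  obtain ⟨f, -, hf⟩ := X.exists_local_lift (hφ.comp X.contMDiff_q)
    (x := (⟨p, X.constField 0 p⟩ : TM n M)) hu
  exact ⟨f, hf⟩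

variable {X}

namespace IsHolomorphicEquivariant

theorem baseProj_apply (hφ : X.IsHolomorphicEquivariant φ A) (x : X.ML) :
    X.baseProj (φ x) = X.baseMap φ (X.baseProj x) := by
  conv_lhs => rw [← X.torusAction_torusCoord x, hφ.equivariant, X.baseProj_torusAction]
  rfl

theorem proj_lift (hφ : X.IsHolomorphicEquivariant φ A) {v w : TM n M}
    (h : X.q v = φ (X.q w)) : v.1 = X.baseMap φ w.1 := by
  rw [← X.baseProj_q v, h, hφ.baseProj_apply]
  rfl

theorem mfderiv_baseMap (hφ : X.IsHolomorphicEquivariant φ A) (p : M) (c : Fin n → ℝ) :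
    mfderiv (𝓡 n) (𝓡 n) (X.baseMap φ) p (∑ k, c k • X.X k p) =
      ∑ i, (A.map ((↑) : ℤ → ℝ) *ᵥ c) i • X.X i (X.baseMap φ p) := by
  obtain ⟨f, hf⟩ := X.exists_lift_zeroSec hφ.smooth p
  set u : TM n M := ⟨p, X.constField 0 p⟩
  have hlift := hf.mono fun w hw => hw.2
  let H := (splitting cov u).symm (∑ k, c k • X.X k p, 0)
  have hH : projDeriv u H = ∑ k, c k • X.X k p := projDeriv_splitting_symm cov u _ _
  have h1 := hφ.mfderiv_lift_horizontal hf.self_of_nhds.1 hlift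
    (connector_splitting_symm cov u _ _) hH
  have h2 := projDeriv_mfderiv hf.self_of_nhds.1
    ((X.contMDiff_baseMap hφ.smooth).mdifferentiable (by simp) p)
    (hlift.mono fun w hw => hφ.proj_lift hw) H
  rw [hH] at h2
  -- `(f u).1 = ψ(p)` is not definitional, but both tangent spaces are the model space.
  have h3 : ∀ r, r = X.baseMap φ p → ∀ b : Fin n → ℝ,
      (∑ i, b i • X.X i r : EuclideanSpace ℝ (Fin n)) = ∑ i, b i • X.X i (X.baseMap φ p) := by
    rintro _ rfl b
    rfl
  exact h2.symm.trans (h1.2.trans (h3 _ (hφ.proj_lift hlift.self_of_nhds) _))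

/-- Compare the metrics of `TM` on the horizontal lifts: these are mapped to horizontal vectors. -/
theorem inner_mfderiv_baseMap (hφ : X.IsHolomorphicEquivariant φ A) (h : Metric n M)
    (hg : ∀ x (v w : TangentSpace (𝓡 n).tangent x),
      X.metric h (φ x) (mfderiv (𝓡 n).tangent (𝓡 n).tangent φ x v)
        (mfderiv (𝓡 n).tangent (𝓡 n).tangent φ x w) = X.metric h x v w)
    (p : M) (v w : TangentSpace (𝓡 n) p) :
    h.inner (X.baseMap φ p) (mfderiv (𝓡 n) (𝓡 n) (X.baseMap φ) p v)
      (mfderiv (𝓡 n) (𝓡 n) (X.baseMap φ) p w) = h.inner p v w := by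
  obtain ⟨f, hf⟩ := X.exists_lift_zeroSec hφ.smooth p
  set u : TM n M := ⟨p, X.constField 0 p⟩
  have hlift := hf.mono fun w hw => hw.2
  let H : TangentSpace (𝓡 n) p → TangentSpace (𝓡 n).tangent u :=
    fun v => (splitting cov u).symm (v, 0)
  have hH : ∀ v, projDeriv u (H v) = v := fun v => projDeriv_splitting_symm cov u _ _
  have hH' : ∀ v, connector cov u (H v) = 0 := fun v => connector_splitting_symm cov u _ _
  have h1 : ∀ v, connector cov (f u) (mfderiv (𝓡 n).tangent (𝓡 n).tangent f u (H v)) = 0 :=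
    fun v => (hφ.mfderiv_lift_horizontal hf.self_of_nhds.1 hlift (hH' v)
      (c := X.coord ⟨p, v⟩) ((hH v).trans (X.sum_coord ⟨p, v⟩).symm)).1
  have h2 : ∀ v, projDeriv (f u) (mfderiv (𝓡 n).tangent (𝓡 n).tangent f u (H v)) =
      mfderiv (𝓡 n) (𝓡 n) (X.baseMap φ) p v := by
    intro v
    have h3 := projDeriv_mfderiv hf.self_of_nhds.1
      ((X.contMDiff_baseMap hφ.smooth).mdifferentiable (by simp) p)
      (hlift.mono fun w hw => hφ.proj_lift hw) (H v)
    rwa [hH] at h3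
  have h4 := hg (X.q u) (X.dq u (H v)) (X.dq u (H w))
  have h5 := X.mfderiv_dq (hφ.smooth _) hf.self_of_nhds.1 hlift
  rw [X.metric_dq, h5, h5] at h4
  have h6 := (X.metric_dq_of_eq h hlift.self_of_nhds _ _).symm.trans h4
  simp only [tangentMetric, h1, hH', hH, h2, map_zero, add_zero] at h6
  have h7 : ∀ r, r = X.baseMap φ p → ∀ a b : EuclideanSpace ℝ (Fin n),
      h.inner r a b = h.inner (X.baseMap φ p) a b := by
    rintro _ rfl _ _
    rfl
  exact (h7 _ (hφ.proj_lift hlift.self_of_nhds) _ _).symm.trans h6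

/-- Local lifts of `φ` map horizontal vectors to horizontal vectors, hence the fibre coordinate of
`φ` along the zero section, which is parallel, has vanishing derivative. -/
theorem isLocallyConstant_torusCoord (hφ : X.IsHolomorphicEquivariant φ A) :
    IsLocallyConstant fun p => X.torusCoord (φ (X.zeroSec p)) := by
  rw [IsLocallyConstant.iff_eventually_eq]
  intro p
  obtain ⟨f, hf⟩ := X.exists_lift_zeroSec hφ.smooth p
  have hsec := X.contMDiff_constField 0
  have h1 := (hsec.continuous.continuousAt (x := p)).eventually hf.eventually_nhds
  have h2 : ∀ᶠ p' in 𝓝 p, HasMFDerivAt (𝓡 n) 𝓘(ℝ, Fin n → ℝ)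
      (fun p' => X.coord (f ⟨p', X.constField 0 p'⟩)) p' 0 := by
    filter_upwards [h1] with p' hp'
    have h3 := hsec.mdifferentiable (by simp) p'
    have h4 := hp'.self_of_nhds.1.mdifferentiableAt (by simp)
    have h5 := ((X.contMDiff_coord.mdifferentiable (by simp)
      (f ⟨p', X.constField 0 p'⟩)).hasMFDerivAt.comp _ h4.hasMFDerivAt).comp p' h3.hasMFDerivAt
    refine HasMFDerivAt.congr_mfderiv h5 ?_
    ext1 v
    obtain ⟨-, hv, -⟩ := X.connector_eq_zero_and_dcoord_eq_zero 0 p' v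
    set B := mfderiv (𝓡 n) (𝓡 n).tangent (fun q => (⟨q, X.constField 0 q⟩ : TM n M)) p' v
    have h6 := hφ.mfderiv_lift_horizontal hp'.self_of_nhds.1
      (hp'.mono fun w hw => hw.2) hv
      (c := X.coord ⟨p', projDeriv ⟨p', X.constField 0 p'⟩ B⟩)
      (X.sum_coord ⟨p', projDeriv ⟨p', X.constField 0 p'⟩ B⟩).symm
    exact (X.connector_eq_zero_iff _ _).1 h6.1
  filter_upwards [eventually_eq_of_mfderiv_eq_zero h2, h1.mono fun p' hp' => hp'.self_of_nhds.2]
    with p' hp' hq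
  have h7 := hf.self_of_nhds.2
  change X.torusCoord (φ (X.q _)) = X.torusCoord (φ (X.q _))
  rw [← hq, ← h7]
  exact congrArg Torus.mk hp'

end IsHolomorphicEquivariant

end

variable (h : Metric n M)

theorem exists_isHolomorphicEquivariant {φ : Equiv.Perm X.ML} (hφ : φ ∈ X.autML h) :
    ∃ A : Matrix (Fin n) (Fin n) ℤ, X.IsHolomorphicEquivariant φ A := by
  obtain ⟨hs, -, -, hJ, ρ, hρ, hφρ⟩ := hφ
  obtain ⟨A, hA⟩ := exists_eq_torusEnd ρ.toAddMonoidHom hρ.1.continuous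
  refine ⟨A, hs, hJ, fun a x => ?_⟩
  rw [hφρ, ← hA]
  rfl

theorem baseMap_symm_baseMap {φ : Equiv.Perm X.ML} (hφ : φ ∈ X.autML h) (p : M) :
    X.baseMap φ.symm (X.baseMap φ p) = p := by
  obtain ⟨A, hA⟩ := X.exists_isHolomorphicEquivariant h (inv_mem hφ)
  have h1 := hA.baseProj_apply (φ (X.zeroSec p))
  change X.baseProj (φ.symm (φ (X.zeroSec p))) = X.baseMap φ.symm (X.baseMap φ p) at h1
  rw [← h1, Equiv.symm_apply_apply]
  rfl

/-- The permutation of `M` induced by `φ ∈ Aut(M_L, g)^{𝕋ⁿ}`. -/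
def basePerm (φ : X.autML h) : Equiv.Perm M where
  toFun := X.baseMap (φ : Equiv.Perm X.ML)
  invFun := X.baseMap (φ : Equiv.Perm X.ML).symm
  left_inv := X.baseMap_symm_baseMap h φ.2
  right_inv := X.baseMap_symm_baseMap h (inv_mem φ.2)

theorem tangentMap_baseMap_mem_lattice {φ : Equiv.Perm X.ML} (hφ : φ ∈ X.autML h) {u : TM n M}
    (hu : u ∈ X.lattice) : tangentMap (𝓡 n) (𝓡 n) (X.baseMap φ) u ∈ X.lattice := by
  obtain ⟨A, hA⟩ := X.exists_isHolomorphicEquivariant h hφ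
  obtain ⟨k, hk⟩ := hu
  refine ⟨A *ᵥ k, ?_⟩
  have h1 := hA.mfderiv_baseMap u.1 (fun i => (k i : ℝ))
  have h2 : u.2 = ∑ i, (k i : ℝ) • X.X i u.1 :=
    hk.trans (Finset.sum_congr rfl fun i _ => (Int.cast_smul_eq_zsmul ℝ _ _).symm)
  change mfderiv (𝓡 n) (𝓡 n) (X.baseMap φ) u.1 u.2 = _
  rw [h2, h1]
  refine Finset.sum_congr rfl fun i _ => ?_
  refine Eq.trans ?_ (Int.cast_smul_eq_zsmul ℝ ((A *ᵥ k) i) (X.X i (X.baseMap φ u.1)))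
  congr 1
  simp [Matrix.mulVec, dotProduct]

theorem basePerm_mem_diffhL (φ : X.autML h) : X.basePerm h φ ∈ X.diffhL h := by
  obtain ⟨A, hA⟩ := X.exists_isHolomorphicEquivariant h φ.2
  have hd : X.basePerm h φ ∈ diffGroup n M :=
    ⟨X.contMDiff_baseMap φ.2.1, X.contMDiff_baseMap φ.2.2.1⟩
  refine ⟨⟨hd, ?_⟩, hd, hA.inner_mfderiv_baseMap h φ.2.2.2.1⟩
  apply Subset.antisymm
  · rintro _ ⟨u, hu, rfl⟩
    exact X.tangentMap_baseMap_mem_lattice h φ.2 hu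
  · intro u hu
    exact ⟨_, X.tangentMap_baseMap_mem_lattice h (inv_mem φ.2) hu,
      tangentMap_symm (inv_mem hd) u⟩

variable [ConnectedSpace M]

theorem push_zeroSec (ψ : X.diffhL h) (p : M) :
    X.push h ψ (X.zeroSec p) = X.zeroSec ((ψ : Equiv.Perm M) p) := by
  refine congrArg X.q (TotalSpace.ext rfl (heq_of_eq ?_))
  change mfderiv (𝓡 n) (𝓡 n) (ψ : Equiv.Perm M) p (X.constField 0 p) = _
  rw [X.constField_zero, map_zero]
  exact (X.constField_zero _).symm

theorem autHom_surjective : Function.Surjective (X.autHom h) := by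
  intro φ
  obtain ⟨A, hA⟩ := X.exists_isHolomorphicEquivariant h φ.2
  obtain ⟨p₀⟩ : Nonempty M := inferInstance
  let ψ : X.diffhL h := ⟨X.basePerm h φ, X.basePerm_mem_diffhL h φ⟩
  -- The constant fibre coordinate of `φ` along the zero section is the torus component.
  let a : Torus n := X.torusCoord ((φ : Equiv.Perm X.ML) (X.zeroSec p₀))
  have ha : ∀ p, X.torusCoord ((φ : Equiv.Perm X.ML) (X.zeroSec p)) = a := fun p =>
    hA.isLocallyConstant_torusCoord.apply_eq_of_preconnectedSpace p p₀
  -- `ψ_*` acts on the frame by the same matrix `A` as the automorphism of the torus.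
  have hR : X.rotation h ψ = A := by
    refine X.rotation_unique (p := (ψ : Equiv.Perm M) p₀) fun k => ?_
    have h1 := X.mfderiv_sum_frame h ψ p₀ (Pi.single k 1)
    have h2 := hA.mfderiv_baseMap p₀ (Pi.single k 1)
    simp only [Matrix.mulVec_single_one] at h1 h2
    exact h1.symm.trans h2
  refine ⟨⟨Multiplicative.ofAdd a, ψ⟩, Subtype.ext (Equiv.ext fun x => ?_)⟩
  change X.torusAction a (X.push h ψ x) = (φ : Equiv.Perm X.ML) x
  have h3 : (φ : Equiv.Perm X.ML) (X.zeroSec (X.baseProj x)) =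
      X.torusAction a (X.zeroSec ((ψ : Equiv.Perm M) (X.baseProj x))) := by
    rw [← ha (X.baseProj x)]
    exact (X.torusAction_torusCoord _).symm
  conv_rhs => rw [← X.torusAction_torusCoord x, hA.equivariant, h3, ← X.torusAction_add, add_comm]
  conv_lhs => rw [← X.torusAction_torusCoord x, X.push_torusAction, X.push_zeroSec, hR,
    ← X.torusAction_add]

end ParallelFrame
end Base

end DuallyFlat

end

theorem proposition4p4 {n : ℕ} {M : Type*} [TopologicalSpace M]
    [ChartedSpace (EuclideanSpace ℝ (Fin n)) M] [IsManifold (𝓡 n) ∞ M] [T2Space M]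
    [ConnectedSpace M] (h : DuallyFlat.Metric n M) (cov : DuallyFlat.AffineConnection n M)
    (hflat : DuallyFlat.IsDuallyFlat h cov) (X : DuallyFlat.ParallelFrame cov) :
    X.IsKahlerCovering h ∧
      ∃ Γ : X.semidirect h ≃* X.autML h,
        ∀ (t : Fin n → ℝ) (ψ : X.diffhL h) (u : DuallyFlat.TM n M),
          (Γ ⟨Multiplicative.ofAdd (DuallyFlat.Torus.mk t), ψ⟩ : Equiv.Perm X.ML) (X.q u) =
            X.q (X.translate t (tangentMap (𝓡 n) (𝓡 n) (ψ : Equiv.Perm M) u)) :=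
  ⟨X.isKahlerCovering h,
    MulEquiv.ofBijective (X.autHom h) ⟨X.autHom_injective h, X.autHom_surjective h⟩,
    fun t ψ u => X.permHom_mk_q h t ψ u⟩
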